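/- Let \(V\) be a Euclidean space of dimension \(n\) and let \(\Phi\subset V\) be a finite reduced root system spanning \(V\) (finite, \(0\notin\Phi\), stable under the orthogonal reflections \(s_\alpha\), \(\alpha\in\Phi\), and \(\Phi\cap\mathbb R\alpha=\{\pm\alpha\}\); integrality is not needed), with Coxeter group \(W\) and simple roots \(\Delta=\{\alpha_1,\dots,\alpha_n\}\). Normalize \(\Phi\) so that all short roots (the roots of minimal length in their irreducible component) have the same length. Let \(\mathcal C_\Phi\) be the set of subspaces spanned by nonempty subsets of \(\Phi\). Let \(\mathcal G\) be a building set associated to \(\Phi\), i.e. \(\mathcal G\subset\mathcal C_\Phi\), \(\mathbb R\alpha\in\mathcal G\) for all \(\alpha\in\Phi\), and every \(C\in\mathcal C_\Phi\) is the direct sum of the maximal elements of \(\mathcal G\) contained in \(C\); assume \(V\in\mathcal G\). Let \(\mathcal C_{fund}\) be the set of subspaces spanned by nonempty subsets of \(\Delta\), and \(\mathcal G_{fund}=\mathcal G\cap\mathcal C_{fund}\). Let \(\delta\) be half the sum of the positive roots. For a subspace \(A\) let \(\pi_A\) be the orthogonal projection of \(\delta\) to \(A\); for \(A\in\mathcal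 G_{fund}\setminus\{V\}\) let \(\delta_A=\delta-\pi_A\) (the projection of \(\delta\) to \(A^\perp\)). For \(B\subsetneq A\) in \(\mathcal G_{fund}\) let \(R^A_B\) be the maximal coefficient of \(\pi_A\), on the simple roots in \(A\), divided by the minimal coefficient of \(\pi_B\), on the simple roots in \(B\). Let \(R^i_j\) be the maximum of the \(R^A_B\) over \(B\subsetneq A\) in \(\mathcal G_{fund}\) with \(\dim A=i\), \(\dim B=j\), and \(R^i_j=1\) if there is no such pair. Let \(0<\epsilon_1<\dots<\epsilon_n=a\) be a suitable list, i.e. \(\epsilon_i>2R^i_{i-1}\epsilon_{i-1}\) for \(i=2,\dots,n\). Let \(H_V=\{x:(x,\delta)=a\}\), \(HS_V=\{x:(x,\delta)\le a\}\), and \(HS_A=\{x:(x,\delta_A)\le a-\epsilon_{\dim A}\}\) for \(A\in\mathcal G_{fund}\setminus\{V\}\). For \(B\in\mathcal C_{fund}\setminus\mathcal G_{fund}\), with maximal elements \(A_1,\dots,A_k\) of \(\mathcal G_{fund}\) contained in \(B\), let \(\overline{HS}_B=\{x:(x,\delta-\sum_i\pi_{A_i})\le a-\sum_i\epsilon_{\dim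 A_i}\}\). Define the nestohedron \(P_{\mathcal G_{fund}}=H_V\cap\bigcap_{A\in\mathcal G_{fund}\setminus\{V\}}HS_A\) and the permutonestohedron \[P_{\mathcal G}(\Phi)=\bigcap_{\sigma\in W}\Big(\bigcap_{A\in\mathcal G_{fund}}\sigma HS_A\ \cap\bigcap_{B\in\mathcal C_{fund}\setminus\mathcal G_{fund}}\sigma\overline{HS}_B\Big).\] Let \(Aut(\Phi)\) be the group of linear automorphisms of \(V\) that leave \(\Phi\) invariant, and \(Aut(P_{\mathcal G}(\Phi))\) the group of isometries of \(V\) that send \(P_{\mathcal G}(\Phi)\) onto itself. Theorem. Suppose that \(\mathcal G\) is \(Aut(\Phi)\)-invariant. Then \(Aut(\Phi)\) is a subgroup of \(Aut(P_{\mathcal G}(\Phi))\). If moreover \(Aut(P_{\mathcal G}(\Phi))\) leaves invariant the set of nestohedra \(\{wP_{\mathcal G_{fund}}: w\in W\}\), then \(Aut(\Phi)=Aut(P_{\mathcal G}(\Phi))\). -/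

import Mathlib

open scoped InnerProductSpace

noncomputable section

namespace Permutonestohedra

variable {V : Type*} [NormedAddCommGroup V] [InnerProductSpace ℝ V] [FiniteDimensional ℝ V]

/-! ### Root systems -/

/-- The orthogonal reflection `s_α` in the hyperplane `α^⊥`. -/
def rootReflection (α : V) : V ≃ₗᵢ[ℝ] V := (ℝ ∙ α)ᗮ.reflection

/-- `Φ` is a (finite, reduced) root system spanning the Euclidean space `V`. The integrality
condition is not imposed, so crystallographic root systems are included as a special case. -/
structure IsRootSystem (Φ : Finset V) : Prop where
  span_eq_top : Submodule.span ℝ (Φ : Set V) = ⊤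
  zero_notMem : (0 : V) ∉ Φ
  refl_mem : ∀ α ∈ Φ, ∀ β ∈ Φ, rootReflection α β ∈ Φ
  reduced : ∀ α ∈ Φ, ∀ c : ℝ, c • α ∈ Φ → c = 1 ∨ c = -1

/-- Two roots belong to the same irreducible component of `Φ`: they are joined by a chain of roots
in which consecutive roots are not orthogonal. -/
def SameComponent (Φ : Finset V) (α β : V) : Prop :=
  Relation.ReflTransGen (fun x y : V => x ∈ Φ ∧ y ∈ Φ ∧ ⟪x, y⟫_ℝ ≠ 0) α β

/-- A short root: a root of minimal length in its irreducible component. -/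
def IsShortRoot (Φ : Finset V) (α : V) : Prop :=
  α ∈ Φ ∧ ∀ β ∈ Φ, SameComponent Φ α β → ‖α‖ ≤ ‖β‖

/-- The normalization: all short roots of all components have the same length. -/
def IsNormalized (Φ : Finset V) : Prop :=
  ∀ α β : V, IsShortRoot Φ α → IsShortRoot Φ β → ‖α‖ = ‖β‖

/-- The Coxeter group `W` of `Φ`. -/
def weylGroup (Φ : Finset V) : Subgroup (V ≃ₗᵢ[ℝ] V) :=
  Subgroup.closure {s | ∃ α ∈ Φ, s = rootReflection α}

/-- The basis `Δ = (α_1, …, α_n)` of `V` is a basis of simple roots of `Φ`: it consists of roots, and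
every root is a nonnegative or a nonpositive linear combination of it. -/
structure IsSimpleBasis {n : ℕ} (Φ : Finset V) (Δ : Module.Basis (Fin n) ℝ V) : Prop where
  mem : ∀ i, Δ i ∈ Φ
  sign : ∀ β ∈ Φ, (∀ i, 0 ≤ Δ.repr β i) ∨ (∀ i, Δ.repr β i ≤ 0)

open Classical in
/-- The positive roots. -/
def posRoots {n : ℕ} (Φ : Finset V) (Δ : Module.Basis (Fin n) ℝ V) : Finset V :=
  Φ.filter (fun β => ∀ i, 0 ≤ Δ.repr β i)

/-- `δ`, half the sum of the positive roots. -/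
def delta {n : ℕ} (Φ : Finset V) (Δ : Module.Basis (Fin n) ℝ V) : V :=
  (1 / 2 : ℝ) • ∑ β ∈ posRoots Φ Δ, β

/-! ### Building sets -/

/-- `𝒞_Φ`: the subspaces spanned by some (at least one) of the roots; equivalently the closure under
sum of the set of lines spanned by the roots. -/
def rootSubspaces (Φ : Finset V) : Set (Submodule ℝ V) :=
  {C | ∃ T : Set V, T ⊆ (Φ : Set V) ∧ T.Nonempty ∧ C = Submodule.span ℝ T}

/-- The maximal elements of `G` among those contained in `C`. -/
def maximalIn (G : Set (Submodule ℝ V)) (C : Submodule ℝ V) : Set (Submodule ℝ V) :=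
  {A | Maximal (fun A' => A' ∈ G ∧ A' ≤ C) A}

/-- `G` is a building set associated to (the arrangement of lines spanned by the roots of) `Φ`:
it contains these lines, and every `C ∈ 𝒞_Φ` is the direct sum of the maximal elements of `G`
contained in `C`. -/
structure IsBuildingSet (Φ : Finset V) (G : Set (Submodule ℝ V)) : Prop where
  subset : G ⊆ rootSubspaces Φ
  line_mem : ∀ α ∈ Φ, (ℝ ∙ α) ∈ G
  indep : ∀ C ∈ rootSubspaces Φ, sSupIndep (maximalIn G C)
  sum_eq : ∀ C ∈ rootSubspaces Φ, sSup (maximalIn G C) = C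

/-- `𝒞_{Φ,fund}`: the subspaces spanned by some (at least one) of the simple roots. -/
def fundSubspaces {n : ℕ} (Δ : Module.Basis (Fin n) ℝ V) : Set (Submodule ℝ V) :=
  {B | ∃ I : Set (Fin n), I.Nonempty ∧ B = Submodule.span ℝ (Δ '' I)}

/-- `G_fund`: the members of `G` that are spanned by some of the simple roots. -/
def fundPart {n : ℕ} (Δ : Module.Basis (Fin n) ℝ V) (G : Set (Submodule ℝ V)) :
    Set (Submodule ℝ V) :=
  G ∩ fundSubspaces Δ

/-! ### The vectors `π_A`, `δ_A`, `δ_B` and suitable lists -/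

/-- `π_A`, the component of `δ` in `A`, so that the orthogonal projection of `δ` to `A^⊥` is
`δ - π_A`. In particular `π_V = δ`. -/
def piVec {n : ℕ} (Φ : Finset V) (Δ : Module.Basis (Fin n) ℝ V) (A : Submodule ℝ V) : V :=
  A.starProjection (delta Φ Δ)

open Classical in
/-- `δ_A` for `A ∈ G_fund`: the orthogonal projection of `δ` to `A^⊥` if `A ≠ V`, and by convention
`δ_V = δ`. -/
def deltaVec {n : ℕ} (Φ : Finset V) (Δ : Module.Basis (Fin n) ℝ V) (A : Submodule ℝ V) : V :=
  if A = ⊤ then delta Φ Δ else Aᗮ.starProjection (delta Φ Δ)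

/-- `δ_B = δ - ∑ π_{A_i}` for `B ∈ 𝒞_{Φ,fund} - G_fund` with `G_fund`-decomposition `⊕ A_i`. -/
def deltaBarVec {n : ℕ} (Φ : Finset V) (Δ : Module.Basis (Fin n) ℝ V) (G : Set (Submodule ℝ V))
    (B : Submodule ℝ V) : V :=
  delta Φ Δ - ∑ᶠ A ∈ maximalIn (fundPart Δ G) B, piVec Φ Δ A

/-- The maximum coefficient of `π_A` with respect to the simple roots in `A`. -/
def maxCoeff {n : ℕ} (Φ : Finset V) (Δ : Module.Basis (Fin n) ℝ V) (A : Submodule ℝ V) : ℝ :=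
  ⨆ i : {i : Fin n // Δ i ∈ A}, Δ.repr (piVec Φ Δ A) i

/-- The minimum coefficient of `π_B` with respect to the simple roots in `B`. -/
def minCoeff {n : ℕ} (Φ : Finset V) (Δ : Module.Basis (Fin n) ℝ V) (B : Submodule ℝ V) : ℝ :=
  ⨅ i : {i : Fin n // Δ i ∈ B}, Δ.repr (piVec Φ Δ B) i

/-- `R^i_j`: the maximum of the ratios `R^A_B` over `B ⊂ A` in `G_fund` of dimensions `j < i`. All
these ratios are at least `1`; adding `1` to the set only says that `R^i_j = 1` if there is no
such pair `B ⊂ A`. -/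
def ratio {n : ℕ} (Φ : Finset V) (Δ : Module.Basis (Fin n) ℝ V) (G : Set (Submodule ℝ V))
    (i j : ℕ) : ℝ :=
  sSup (insert 1 {r | ∃ A ∈ fundPart Δ G, ∃ B ∈ fundPart Δ G, B < A ∧
    Module.finrank ℝ A = i ∧ Module.finrank ℝ B = j ∧ r = maxCoeff Φ Δ A / minCoeff Φ Δ B})

/-- `ε_1 < ε_2 < ⋯ < ε_n` is a suitable list (of positive real numbers). Only the values
`ε 1, …, ε n` matter; the number `a` is `ε n`. -/
structure IsSuitable {n : ℕ} (Φ : Finset V) (Δ : Module.Basis (Fin n) ℝ V)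
    (G : Set (Submodule ℝ V)) (ε : ℕ → ℝ) : Prop where
  pos : ∀ i, 1 ≤ i → i ≤ n → 0 < ε i
  lt : ∀ i, 2 ≤ i → i ≤ n → ε (i - 1) < ε i
  ratio_lt : ∀ i, 2 ≤ i → i ≤ n → 2 * ratio Φ Δ G i (i - 1) * ε (i - 1) < ε i

/-! ### The nestohedron and the permutonestohedron -/

/-- The hyperplane `H_V`. -/
def hyperplaneTop {n : ℕ} (Φ : Finset V) (Δ : Module.Basis (Fin n) ℝ V) (ε : ℕ → ℝ) : Set V :=
  {x | ⟪x, delta Φ Δ⟫_ℝ = ε n}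

open Classical in
/-- `HS_A` for `A ∈ G_fund` (including `A = V`): the half-space containing the origin and bounded by
`H_A = {x | (x, δ_A) = a - ε_{dim A}}`, respectively by `H_V = {x | (x, δ) = a}`. -/
def halfSpace {n : ℕ} (Φ : Finset V) (Δ : Module.Basis (Fin n) ℝ V) (ε : ℕ → ℝ)
    (A : Submodule ℝ V) : Set V :=
  {x | ⟪x, deltaVec Φ Δ A⟫_ℝ ≤ if A = ⊤ then ε n else ε n - ε (Module.finrank ℝ A)}

/-- The half-space containing the origin and bounded by
`{x | (x, δ_B) = a - ε_{dim A_1} - ⋯ - ε_{dim A_k}}`, for `B ∈ 𝒞_{Φ,fund} - G_fund` with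
`G_fund`-decomposition `A_1 ⊕ ⋯ ⊕ A_k`. -/
def halfSpaceBar {n : ℕ} (Φ : Finset V) (Δ : Module.Basis (Fin n) ℝ V) (G : Set (Submodule ℝ V))
    (ε : ℕ → ℝ) (B : Submodule ℝ V) : Set V :=
  {x | ⟪x, deltaBarVec Φ Δ G B⟫_ℝ ≤
    ε n - ∑ᶠ A ∈ maximalIn (fundPart Δ G) B, ε (Module.finrank ℝ A)}

/-- The nestohedron `P_{G_fund}`: the intersection of `H_V` with the half-spaces `HS_A`,
`A ∈ G_fund - {V}`. -/
def nestohedron {n : ℕ} (Φ : Finset V) (Δ : Module.Basis (Fin n) ℝ V) (G : Set (Submodule ℝ V))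
    (ε : ℕ → ℝ) : Set V :=
  hyperplaneTop Φ Δ ε ∩ ⋂ A ∈ fundPart Δ G \ {⊤}, halfSpace Φ Δ ε A

/-- The permutonestohedron `P_G(Φ)`: the intersection of the half-spaces `σ HS_A` and of their
analogues for `B ∈ 𝒞_{Φ,fund} - G_fund`, `σ ∈ W`. -/
def permutonestohedron {n : ℕ} (Φ : Finset V) (Δ : Module.Basis (Fin n) ℝ V)
    (G : Set (Submodule ℝ V)) (ε : ℕ → ℝ) : Set V :=
  ⋂ σ ∈ weylGroup Φ,
    (⋂ A ∈ fundPart Δ G, σ '' halfSpace Φ Δ ε A) ∩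
    (⋂ B ∈ fundSubspaces Δ \ fundPart Δ G, σ '' halfSpaceBar Φ Δ G ε B)

/-- The set of the nestohedra `w P_{G_fund}`, `w ∈ W`. -/
def chamberNestohedra {n : ℕ} (Φ : Finset V) (Δ : Module.Basis (Fin n) ℝ V)
    (G : Set (Submodule ℝ V)) (ε : ℕ → ℝ) : Set (Set V) :=
  {N | ∃ w ∈ weylGroup Φ, N = w '' nestohedron Φ Δ G ε}

/-! ### The two automorphism groups -/

/-- `Aut(Φ)`: the linear automorphisms of `V` that leave `Φ` invariant. -/
def rootAut (Φ : Finset V) : Subgroup (V ≃ₗ[ℝ] V) where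
  carrier := {f | f '' (Φ : Set V) = Φ}
  one_mem' := by simp
  mul_mem' {f g} hf hg := by
    change (f * g : V ≃ₗ[ℝ] V) '' (Φ : Set V) = Φ
    have h : ⇑(f * g : V ≃ₗ[ℝ] V) = ⇑f ∘ ⇑g := rfl
    rw [h, Set.image_comp, Set.mem_ofPred_eq.mp hg, Set.mem_ofPred_eq.mp hf]
  inv_mem' {f} hf := by
    change (f⁻¹ : V ≃ₗ[ℝ] V) '' (Φ : Set V) = Φ
    conv_lhs => rw [← Set.mem_ofPred_eq.mp hf]
    rw [← Set.image_comp]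
    have h : ⇑(f⁻¹ : V ≃ₗ[ℝ] V) ∘ ⇑f = id := by
      funext x; exact f.symm_apply_apply x
    rw [h, Set.image_id]

/-- `Aut(P)`: the isometries of `V` that send `P` onto itself. -/
def isometryAut (P : Set V) : Subgroup (V ≃ᵢ V) where
  carrier := {θ | θ '' P = P}
  one_mem' := by
    change (id : V → V) '' P = P
    exact Set.image_id P
  mul_mem' {f g} hf hg := by
    change (f * g : V ≃ᵢ V) '' P = P
    have h : ⇑(f * g : V ≃ᵢ V) = ⇑f ∘ ⇑g := rfl
    rw [h, Set.image_comp, Set.mem_ofPred_eq.mp hg, Set.mem_ofPred_eq.mp hf]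
  inv_mem' {f} hf := by
    change (f⁻¹ : V ≃ᵢ V) '' P = P
    conv_lhs => rw [← Set.mem_ofPred_eq.mp hf]
    rw [← Set.image_comp]
    have h : ⇑(f⁻¹ : V ≃ᵢ V) ∘ ⇑f = id := by
      funext x; exact f.symm_apply_apply x
    rw [h, Set.image_id]

/-- Linear automorphisms of `V`, viewed as bijections of `V`. -/
def linearToPerm : (V ≃ₗ[ℝ] V) →* Equiv.Perm V where
  toFun f := f.toEquiv
  map_one' := rfl
  map_mul' _ _ := rfl

/-- Isometries of `V`, viewed as bijections of `V`. -/
def isometryToPerm : (V ≃ᵢ V) →* Equiv.Perm V where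
  toFun f := f.toEquiv
  map_one' := rfl
  map_mul' _ _ := rfl

end Permutonestohedra

end

set_option linter.unusedSectionVars false

noncomputable section

namespace Permutonestohedra

variable {V : Type*} [NormedAddCommGroup V] [InnerProductSpace ℝ V] [FiniteDimensional ℝ V]

/-! ### Reflections and automorphisms of a root system -/

/-! Aut(Φ) ⊆ Aut(P): a linear automorphism preserves Cartan numbers, so it scales each irreducible
component by a constant; it maps short roots to short roots, so the normalization makes it an
isometry (`inner_map_map`). After multiplication by an element of W it fixes δ and permutes the
simple roots (`exists_weyl_mul`). Such a map preserves G_fund, carries π_A to π_{gA} and normalizes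
W, so it permutes the half-spaces that define P.

Conversely, let θ permute the nestohedra wP. They are bounded, and this forces θ 0 = 0
(`map_zero_of_permutes`), so θ is linear by Mazur–Ulam. A nestohedron has interior relative to H_V
(`exists_relint_nestohedron`), so it determines δ, and θ permutes the orbit Wδ. Compose with an
element of W to get g fixing δ. Since α_i = δ - s_i δ, while δ - wδ is always a nonnegative
combination of simple roots, g and its inverse map the simple cone into itself. Hence g permutes the
simple roots (`exists_simple_of_cone`), and therefore preserves Φ (`map_mem_of_simple`).

The quantitative point is the interior, where the suitable list enters. By `pow_mul_coeff_le`, each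
coefficient of π_A times ε_n is at least 2^codim(A) ε_{dim A} times that of δ. This is proved by
enlarging A inside G one simple root at a time (`fundSpan_insert_mem`), because suitability only
compares consecutive dimensions. -/

theorem rootReflection_apply (α x : V) :
    rootReflection α x = x - (2 * ⟪α, x⟫_ℝ / ‖α‖ ^ 2) • α := by
  rw [rootReflection, Submodule.reflection_orthogonal_apply, Submodule.reflection_singleton_apply]
  simp only [RCLike.ofReal_real_eq_id, id_eq]
  rw [neg_sub, ← Nat.cast_smul_eq_nsmul ℝ, smul_smul, Nat.cast_ofNat, mul_div_assoc]

theorem rootReflection_rootReflection (α x : V) :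
    rootReflection α (rootReflection α x) = x :=
  Submodule.reflection_reflection _ _

theorem rootReflection_self (α : V) : rootReflection α α = -α :=
  Submodule.reflection_orthogonalComplement_singleton_eq_neg α

theorem map_rootReflection (g : V ≃ₗᵢ[ℝ] V) (α x : V) :
    g (rootReflection α x) = rootReflection (g α) (g x) := by
  simp [rootReflection_apply]

theorem rootReflection_mem_weylGroup {Φ : Finset V} {α : V} (hα : α ∈ Φ) :
    rootReflection α ∈ weylGroup Φ :=
  Subgroup.subset_closure ⟨α, hα, rfl⟩

namespace IsRootSystem

variable {Φ : Finset V}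

theorem ne_zero (hΦ : IsRootSystem Φ) {α : V} (hα : α ∈ Φ) : α ≠ 0 :=
  fun h => hΦ.zero_notMem (h ▸ hα)

theorem norm_sq_pos (hΦ : IsRootSystem Φ) {α : V} (hα : α ∈ Φ) : 0 < ‖α‖ ^ 2 := by
  have := norm_pos_iff.mpr (hΦ.ne_zero hα)
  positivity

/-- The reflection in `α`, written with the coroot functional of `α`. -/
theorem preReflection_eq (α : V) (x : V) :
    Module.preReflection α ((2 / ‖α‖ ^ 2) • (innerₗ V α)) x = rootReflection α x := by
  rw [Module.preReflection_apply, rootReflection_apply]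
  simp [div_mul_eq_mul_div]

/-- Linear automorphisms of `Φ` preserve the Cartan numbers. -/
theorem cartan_map (hΦ : IsRootSystem Φ) {f : V ≃ₗ[ℝ] V} (hf : f ∈ rootAut Φ) {α : V}
    (hα : α ∈ Φ) (x : V) :
    2 / ‖f α‖ ^ 2 * ⟪f α, f x⟫_ℝ = 2 / ‖α‖ ^ 2 * ⟪α, x⟫_ℝ := by
  have hf' : f '' (Φ : Set V) = Φ := hf
  have hmem : ∀ β ∈ Φ, f β ∈ Φ := fun β hβ => by
    rw [← Finset.mem_coe, ← hf']; exact ⟨β, hβ, rfl⟩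
  have hmem' : ∀ β ∈ Φ, f.symm β ∈ Φ := fun β hβ => by
    rw [← Finset.mem_coe, ← hf'] at hβ
    obtain ⟨γ, hγ, rfl⟩ := hβ
    simpa using hγ
  have key : (((2 / ‖f α‖ ^ 2) • (innerₗ V (f α))) ∘ₗ (f : V →ₗ[ℝ] V) : V →ₗ[ℝ] ℝ) =
      (2 / ‖α‖ ^ 2) • (innerₗ V α) := by
    have h2 : ∀ {β : V}, β ∈ Φ → 2 / ‖β‖ ^ 2 * ⟪β, β⟫_ℝ = 2 := fun {β} hβ => by
      rw [real_inner_self_eq_norm_sq, div_mul_cancel₀ _ (hΦ.norm_sq_pos hβ).ne']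
    -- A functional with value 2 at α whose pre-reflection preserves the finite spanning set Φ is
    -- unique. For the pulled-back coroot that pre-reflection is f⁻¹ s_{fα} f.
    refine Module.Dual.eq_of_preReflection_mapsTo (x := α) Φ.finite_toSet hΦ.span_eq_top
      (by simpa using h2 (hmem α hα)) ?_ (by simpa using h2 hα) ?_
    · intro β hβ
      have h : Module.preReflection α
          (((2 / ‖f α‖ ^ 2) • (innerₗ V (f α))) ∘ₗ (f : V →ₗ[ℝ] V) : V →ₗ[ℝ] ℝ) β =
          f.symm (rootReflection (f α) (f β)) := by
        rw [LinearEquiv.eq_symm_apply, ← preReflection_eq, Module.preReflection_apply,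
          Module.preReflection_apply, map_sub, map_smul]
        rfl
      rw [h]
      exact hmem' _ (hΦ.refl_mem _ (hmem α hα) _ (hmem β hβ))
    · intro β hβ
      rw [preReflection_eq]
      exact hΦ.refl_mem _ hα _ hβ
  simpa using LinearMap.congr_fun key x

theorem map_mem {f : V ≃ₗ[ℝ] V} (hf : f ∈ rootAut Φ) {β : V} (hβ : β ∈ Φ) : f β ∈ Φ := by
  have hf' : f '' (Φ : Set V) = Φ := hf
  rw [← Finset.mem_coe, ← hf']; exact ⟨β, hβ, rfl⟩

/-- Preserved Cartan numbers keep non-orthogonality, so a chain goes to a chain. -/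
theorem sameComponent_map {f : V ≃ₗ[ℝ] V} (hΦ : IsRootSystem Φ) (hf : f ∈ rootAut Φ) {α β : V}
    (h : SameComponent Φ α β) : SameComponent Φ (f α) (f β) := by
  refine Relation.ReflTransGen.lift f ?_ α β h
  rintro x y ⟨hx, hy, hxy⟩
  refine ⟨map_mem hf hx, map_mem hf hy, fun h0 => hxy ?_⟩
  have := hΦ.cartan_map hf hx y
  rw [h0, mul_zero] at this
  have h3 := hΦ.norm_sq_pos hx
  rcases mul_eq_zero.mp this.symm with h | h
  · exact absurd h (by positivity)
  · exact h

/-- A linear automorphism scales the roots of one irreducible component by a common factor. -/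
theorem norm_ratio_const {f : V ≃ₗ[ℝ] V} (hΦ : IsRootSystem Φ) (hf : f ∈ rootAut Φ) {α β : V}
    (h : SameComponent Φ α β) : ‖f α‖ * ‖β‖ = ‖f β‖ * ‖α‖ := by
  induction h with
  | refl => ring
  | @tail β γ _ hβγ ih =>
    obtain ⟨hβ, hγ, hne⟩ := hβγ
    have h1 := hΦ.cartan_map hf hβ γ
    have h2 := hΦ.cartan_map hf hγ β
    rw [real_inner_comm (f β), real_inner_comm β] at h2
    have b1 := norm_pos_iff.mpr (hΦ.ne_zero hβ)
    have b2 := norm_pos_iff.mpr (hΦ.ne_zero hγ)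
    have b3 := norm_pos_iff.mpr (hΦ.ne_zero (map_mem hf hβ))
    have b4 := norm_pos_iff.mpr (hΦ.ne_zero (map_mem hf hγ))
    -- Eliminate ⟪f β, f γ⟫ between the two Cartan identities, then cancel ⟪β, γ⟫ ≠ 0.
    have h3 : ‖f β‖ ^ 2 * ‖γ‖ ^ 2 = ‖f γ‖ ^ 2 * ‖β‖ ^ 2 := by
      field_simp at h1 h2
      have : ⟪β, γ⟫_ℝ * (‖f β‖ ^ 2 * ‖γ‖ ^ 2) = ⟪β, γ⟫_ℝ * (‖f γ‖ ^ 2 * ‖β‖ ^ 2) := by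
        linear_combination (-‖γ‖ ^ 2) * h1 + ‖β‖ ^ 2 * h2
      exact mul_left_cancel₀ hne this
    have h4 : ‖f β‖ * ‖γ‖ = ‖f γ‖ * ‖β‖ := by
      rw [← mul_pow, ← mul_pow] at h3
      exact (pow_left_inj₀ (by positivity) (by positivity) two_ne_zero).mp h3
    apply mul_right_cancel₀ b1.ne'
    linear_combination ‖γ‖ * ih + ‖α‖ * h4

theorem exists_shortRoot {α : V} (hα : α ∈ Φ) :
    ∃ γ, SameComponent Φ α γ ∧ IsShortRoot Φ γ := by
  classical
  obtain ⟨γ, hγ, hmin⟩ := Finset.exists_min_image (Φ.filter (SameComponent Φ α)) (‖·‖)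
    ⟨α, Finset.mem_filter.mpr ⟨hα, Relation.ReflTransGen.refl⟩⟩
  rw [Finset.mem_filter] at hγ
  exact ⟨γ, hγ.2, hγ.1, fun β hβ h => hmin β (Finset.mem_filter.mpr ⟨hβ, hγ.2.trans h⟩)⟩

theorem symm_mem_rootAut {f : V ≃ₗ[ℝ] V} (hf : f ∈ rootAut Φ) : f.symm ∈ rootAut Φ :=
  (rootAut Φ).inv_mem hf

/-- A common scaling factor on a component keeps the order of lengths, so minimality can be tested
on preimages. -/
theorem isShortRoot_map {f : V ≃ₗ[ℝ] V} (hΦ : IsRootSystem Φ) (hf : f ∈ rootAut Φ) {γ : V}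
    (h : IsShortRoot Φ γ) : IsShortRoot Φ (f γ) := by
  refine ⟨map_mem hf h.1, fun β hβ hs => ?_⟩
  have hβ' := map_mem (symm_mem_rootAut hf) hβ
  have hs' := hΦ.sameComponent_map (symm_mem_rootAut hf) hs
  rw [LinearEquiv.symm_apply_apply] at hs'
  have hle := h.2 _ hβ' hs'
  have hr := hΦ.norm_ratio_const hf hs'
  rw [LinearEquiv.apply_symm_apply] at hr
  have b1 := norm_pos_iff.mpr (hΦ.ne_zero h.1)
  have b2 := norm_pos_iff.mpr (hΦ.ne_zero hβ)
  refine le_of_mul_le_mul_right ?_ b1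
  rw [← hr]
  exact mul_le_mul_of_nonneg_left hle (norm_nonneg _)

/-- The scaling factor on the component of α is read off at a short root. As f may permute
components, its value 1 needs short roots of equal length across components. -/
theorem norm_map (hΦ : IsRootSystem Φ) (hnorm : IsNormalized Φ) {f : V ≃ₗ[ℝ] V}
    (hf : f ∈ rootAut Φ) {α : V} (hα : α ∈ Φ) : ‖f α‖ = ‖α‖ := by
  obtain ⟨γ, hs, hγ⟩ := exists_shortRoot hα
  have h1 := hnorm _ _ (hΦ.isShortRoot_map hf hγ) hγ
  have h2 := hΦ.norm_ratio_const hf hs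
  rw [h1, mul_comm] at h2
  exact mul_left_cancel₀ (norm_pos_iff.mpr (hΦ.ne_zero hγ.1)).ne' h2

/-- Linear automorphisms of a normalized root system are isometries. -/
theorem inner_map_map (hΦ : IsRootSystem Φ) (hnorm : IsNormalized Φ) {f : V ≃ₗ[ℝ] V}
    (hf : f ∈ rootAut Φ) (x y : V) : ⟪f x, f y⟫_ℝ = ⟪x, y⟫_ℝ := by
  have hx : x ∈ Submodule.span ℝ (Φ : Set V) := hΦ.span_eq_top ▸ Submodule.mem_top
  induction hx using Submodule.span_induction with
  | mem α hα =>
    have h1 := hΦ.cartan_map hf hα y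
    rw [hΦ.norm_map hnorm hf hα] at h1
    have := hΦ.norm_sq_pos hα
    exact mul_left_cancel₀ (by positivity) h1
  | zero => simp
  | add u v _ _ hu hv => rw [map_add, inner_add_left, inner_add_left, hu, hv]
  | smul c u _ hu => rw [map_smul, real_inner_smul_left, real_inner_smul_left, hu]

theorem weyl_mem_root (hΦ : IsRootSystem Φ) {w : V ≃ₗᵢ[ℝ] V} (hw : w ∈ weylGroup Φ) :
    w.toLinearEquiv ∈ rootAut Φ := by
  change w '' (Φ : Set V) = Φ
  induction hw using Subgroup.closure_induction with
  | mem s hs =>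
    obtain ⟨α, hα, rfl⟩ := hs
    refine Set.Subset.antisymm ?_ fun β hβ => ?_
    · rintro _ ⟨β, hβ, rfl⟩
      exact hΦ.refl_mem _ hα _ hβ
    · exact ⟨_, hΦ.refl_mem _ hα _ hβ, rootReflection_rootReflection _ _⟩
  | one => simp
  | mul f g _ _ hf hg => rw [LinearIsometryEquiv.coe_mul, Set.image_comp, hg, hf]
  | inv f _ hf =>
    conv_lhs => rw [← hf]
    rw [← Set.image_comp, ← LinearIsometryEquiv.coe_mul, inv_mul_cancel]
    simp

theorem weyl_apply_mem (hΦ : IsRootSystem Φ) {w : V ≃ₗᵢ[ℝ] V} (hw : w ∈ weylGroup Φ) {β : V}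
    (hβ : β ∈ Φ) : w β ∈ Φ :=
  map_mem (hΦ.weyl_mem_root hw) hβ

theorem finite_weylGroup (hΦ : IsRootSystem Φ) : Finite (weylGroup Φ) := by
  let F : weylGroup Φ → (Φ → Φ) := fun w α => ⟨w.1 α, hΦ.weyl_apply_mem w.2 α.2⟩
  refine Finite.of_injective F fun w w' h => Subtype.ext ?_
  apply LinearIsometryEquiv.toLinearEquiv_injective
  apply LinearEquiv.toLinearMap_injective
  refine LinearMap.ext_on hΦ.span_eq_top fun α hα => ?_
  exact congrArg Subtype.val (congrFun h ⟨α, hα⟩)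

/-- Isometries preserving `Φ` normalize the Coxeter group. -/
theorem conj_mem_weylGroup {g : V ≃ₗᵢ[ℝ] V} (hg : ∀ α ∈ Φ, g α ∈ Φ)
    {w : V ≃ₗᵢ[ℝ] V} (hw : w ∈ weylGroup Φ) : g * w * g⁻¹ ∈ weylGroup Φ := by
  induction hw using Subgroup.closure_induction with
  | mem s hs =>
    obtain ⟨α, hα, rfl⟩ := hs
    have : g * rootReflection α * g⁻¹ = rootReflection (g α) := by
      ext x
      change g (rootReflection α (g.symm x)) = _
      rw [map_rootReflection, LinearIsometryEquiv.apply_symm_apply]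
    rw [this]
    exact rootReflection_mem_weylGroup (hg α hα)
  | one => simp [one_mem]
  | mul u v _ _ hu hv =>
    have : g * (u * v) * g⁻¹ = (g * u * g⁻¹) * (g * v * g⁻¹) := by group
    rw [this]; exact mul_mem hu hv
  | inv u _ hu =>
    have : g * u⁻¹ * g⁻¹ = (g * u * g⁻¹)⁻¹ := by group
    rw [this]; exact inv_mem hu

end IsRootSystem

section SimpleRoots

/-! ### Simple roots and the half-sum of the positive roots -/

variable {n : ℕ} {Φ : Finset V} {Δ : Module.Basis (Fin n) ℝ V}

theorem mem_posRoots {β : V} : β ∈ posRoots Φ Δ ↔ β ∈ Φ ∧ ∀ i, 0 ≤ Δ.repr β i := by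
  simp [posRoots]

namespace IsSimpleBasis

theorem simple_mem_posRoots (hΔ : IsSimpleBasis Φ Δ) (i : Fin n) : Δ i ∈ posRoots Φ Δ := by
  classical
  refine mem_posRoots.mpr ⟨hΔ.mem i, fun j => ?_⟩
  rw [Module.Basis.repr_self, Finsupp.single_apply]
  split_ifs <;> norm_num

theorem repr_simple_of_ne {i j : Fin n} (h : j ≠ i) : Δ.repr (Δ i) j = 0 := by
  rw [Module.Basis.repr_self, Finsupp.single_eq_of_ne h]

theorem repr_rootReflection (i : Fin n) {j : Fin n} (h : j ≠ i) (β : V) :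
    Δ.repr (rootReflection (Δ i) β) j = Δ.repr β j := by
  simp [rootReflection_apply, Finsupp.single_eq_of_ne h]

/-- A simple reflection permutes the positive roots other than the simple root itself. -/
theorem rootReflection_mem_posRoots (hΦ : IsRootSystem Φ) (hΔ : IsSimpleBasis Φ Δ) {i : Fin n}
    {β : V} (hβ : β ∈ posRoots Φ Δ) (hne : β ≠ Δ i) :
    rootReflection (Δ i) β ∈ posRoots Φ Δ ∧ rootReflection (Δ i) β ≠ Δ i := by
  rw [mem_posRoots] at hβ
  obtain ⟨hβ, hpos⟩ := hβ
  have hmem := hΦ.refl_mem _ (hΔ.mem i) _ hβ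
  -- Since Φ is reduced, β is not a multiple of Δ i. A second nonzero coordinate is unchanged by the
  -- reflection and decides the sign of the image.
  obtain ⟨j, hji, hj⟩ : ∃ j, j ≠ i ∧ Δ.repr β j ≠ 0 := by
    by_contra! h
    have hβi : β = (Δ.repr β i) • Δ i := by
      apply Δ.repr.injective
      ext j
      by_cases hj : j = i
      · subst hj; simp
      · rw [h j hj, map_smul, Finsupp.smul_apply, repr_simple_of_ne hj, smul_zero]
    rcases hΦ.reduced _ (hΔ.mem i) _ (hβi ▸ hβ) with h1 | h1
    · rw [h1, one_smul] at hβi; exact hne hβi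
    · linarith [hpos i]
  have hjpos : 0 < Δ.repr β j := lt_of_le_of_ne (hpos j) hj.symm
  constructor
  · refine mem_posRoots.mpr ⟨hmem, ?_⟩
    rcases hΔ.sign _ hmem with h | h
    · exact h
    · have := h j
      rw [repr_rootReflection i hji] at this
      linarith
  · intro h
    have := repr_rootReflection (Δ := Δ) i hji β
    rw [h, repr_simple_of_ne hji] at this
    exact hj this.symm

/-- A sum over a set of vectors permuted by the reflection in `α` is orthogonal to `α`. -/
theorem inner_sum_eq_zero {α : V} (hα : α ≠ 0) {T : Finset V}
    (hT : ∀ β ∈ T, rootReflection α β ∈ T) : ⟪∑ β ∈ T, β, α⟫_ℝ = 0 := by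
  have h1 : rootReflection α (∑ β ∈ T, β) = ∑ β ∈ T, β := by
    rw [map_sum]
    refine Finset.sum_bij' (fun β _ => rootReflection α β) (fun β _ => rootReflection α β)
      hT hT ?_ ?_ ?_ <;> simp [rootReflection_rootReflection]
  rw [rootReflection_apply, sub_eq_self, smul_eq_zero, or_iff_left hα] at h1
  have : 0 < ‖α‖ := norm_pos_iff.mpr hα
  rw [real_inner_comm]
  field_simp at h1
  linarith

/-- The simple reflection permutes the other positive roots, so their sum is orthogonal to Δ i and
only the summand Δ i / 2 of δ contributes. -/
theorem inner_delta_simple (hΦ : IsRootSystem Φ) (hΔ : IsSimpleBasis Φ Δ) (i : Fin n) :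
    ⟪delta Φ Δ, Δ i⟫_ℝ = ‖Δ i‖ ^ 2 / 2 := by
  classical
  have h := inner_sum_eq_zero (hΦ.ne_zero (hΔ.mem i)) (T := (posRoots Φ Δ).erase (Δ i))
    (fun β hβ => by
      rw [Finset.mem_erase] at hβ ⊢
      exact (rootReflection_mem_posRoots hΦ hΔ hβ.2 hβ.1).symm)
  rw [delta, ← Finset.add_sum_erase _ _ (hΔ.simple_mem_posRoots i), real_inner_smul_left,
    inner_add_left, h, real_inner_self_eq_norm_sq]
  ring

theorem rootReflection_delta (hΦ : IsRootSystem Φ) (hΔ : IsSimpleBasis Φ Δ) (i : Fin n) :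
    rootReflection (Δ i) (delta Φ Δ) = delta Φ Δ - Δ i := by
  have := hΦ.norm_sq_pos (hΔ.mem i)
  rw [rootReflection_apply, real_inner_comm, inner_delta_simple hΦ hΔ]
  have h : 2 * (‖Δ i‖ ^ 2 / 2) / ‖Δ i‖ ^ 2 = 1 := by
    rw [mul_div_cancel₀ _ two_ne_zero, div_self this.ne']
  rw [h, one_smul]

theorem inner_delta_posRoot (hΦ : IsRootSystem Φ) (hΔ : IsSimpleBasis Φ Δ) {β : V}
    (hβ : β ∈ posRoots Φ Δ) : 0 < ⟪delta Φ Δ, β⟫_ℝ := by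
  rw [mem_posRoots] at hβ
  rw [← Δ.sum_repr β, inner_sum]
  obtain ⟨j, hj⟩ : ∃ j, Δ.repr β j ≠ 0 := by
    by_contra! h
    exact hΦ.ne_zero hβ.1 (Δ.repr.map_eq_zero_iff.mp (Finsupp.ext h))
  have hp : ∀ i, 0 < ⟪delta Φ Δ, Δ i⟫_ℝ := fun i => by
    rw [inner_delta_simple hΦ hΔ]
    have := hΦ.norm_sq_pos (hΔ.mem i)
    positivity
  refine Finset.sum_pos' (fun i _ => ?_) ⟨j, Finset.mem_univ _, ?_⟩
  · rw [real_inner_smul_right]; exact mul_nonneg (hβ.2 i) (hp i).le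
  · rw [real_inner_smul_right]
    exact mul_pos (lt_of_le_of_ne (hβ.2 j) hj.symm) (hp j)

theorem neg_mem (hΦ : IsRootSystem Φ) {β : V} (hβ : β ∈ Φ) : -β ∈ Φ := by
  have := hΦ.refl_mem _ hβ _ hβ
  rwa [rootReflection_self] at this

theorem mem_or_neg_mem (hΦ : IsRootSystem Φ) (hΔ : IsSimpleBasis Φ Δ) {β : V} (hβ : β ∈ Φ) :
    β ∈ posRoots Φ Δ ∨ -β ∈ posRoots Φ Δ := by
  rcases hΔ.sign β hβ with h | h
  · exact Or.inl (mem_posRoots.mpr ⟨hβ, h⟩)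
  · exact Or.inr (mem_posRoots.mpr ⟨neg_mem hΦ hβ, fun i => by simpa using h i⟩)

/-- An isometry fixing `δ` which, together with its inverse, sends the simple roots into the cone
they span permutes the simple roots. -/
theorem exists_simple_of_cone (hΦ : IsRootSystem Φ) (hΔ : IsSimpleBasis Φ Δ) {g : V ≃ₗᵢ[ℝ] V}
    (hg : g (delta Φ Δ) = delta Φ Δ) (h1 : ∀ i j, 0 ≤ Δ.repr (g (Δ i)) j)
    (h2 : ∀ i j, 0 ≤ Δ.repr (g.symm (Δ i)) j) (i : Fin n) : ∃ j, g (Δ i) = Δ j := by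
  classical
  obtain ⟨j, hj⟩ : ∃ j, Δ.repr (g (Δ i)) j ≠ 0 := by
    by_contra! h
    have : g (Δ i) = 0 := Δ.repr.map_eq_zero_iff.mp (Finsupp.ext h)
    exact hΦ.ne_zero (hΔ.mem i) (by simpa using this)
  -- A nonnegative matrix with nonnegative inverse is monomial: the off-diagonal entries of the
  -- product vanish term by term.
  have hexp : ∀ k, Δ.repr (Δ i) k =
      ∑ l, Δ.repr (g (Δ i)) l * Δ.repr (g.symm (Δ l)) k := fun k => by
    conv_lhs => rw [← g.symm_apply_apply (Δ i), ← Δ.sum_repr (g (Δ i))]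
    simp only [map_sum, map_smul, Finsupp.coe_finsetSum, Finset.sum_apply, Finsupp.smul_apply,
      smul_eq_mul]
  have hz : ∀ k, k ≠ i → Δ.repr (g.symm (Δ j)) k = 0 := fun k hk => by
    have h := hexp k
    rw [repr_simple_of_ne hk] at h
    have h3 := (Finset.sum_eq_zero_iff_of_nonneg
      (fun l _ => mul_nonneg (h1 i l) (h2 l k))).mp h.symm j (Finset.mem_univ _)
    exact (mul_eq_zero.mp h3).resolve_left hj
  obtain ⟨c, hc⟩ : ∃ c : ℝ, g.symm (Δ j) = c • Δ i := by
    refine ⟨Δ.repr (g.symm (Δ j)) i, Δ.repr.injective ?_⟩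
    ext k
    by_cases hk : k = i
    · subst hk; simp
    · rw [hz k hk, map_smul, Finsupp.smul_apply, repr_simple_of_ne hk, smul_zero]
  refine ⟨j, ?_⟩
  -- Lengths scale by c², pairings with the fixed δ by c; hence c = 1.
  have hn : ‖Δ j‖ ^ 2 = c ^ 2 * ‖Δ i‖ ^ 2 := by
    rw [← g.symm.norm_map (Δ j), hc, norm_smul, mul_pow, Real.norm_eq_abs, sq_abs]
  have hin : ‖Δ j‖ ^ 2 / 2 = c * (‖Δ i‖ ^ 2 / 2) := by
    rw [← inner_delta_simple hΦ hΔ, ← inner_delta_simple hΦ hΔ, ← g.symm.inner_map_map, hc,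
      real_inner_smul_right, show g.symm (delta Φ Δ) = delta Φ Δ by
        rw [LinearIsometryEquiv.symm_apply_eq, hg]]
  have hi := hΦ.norm_sq_pos (hΔ.mem i)
  have hj' := hΦ.norm_sq_pos (hΔ.mem j)
  have hc0 : c ≠ 0 := by rintro rfl; simp at hn; exact hΦ.ne_zero (hΔ.mem j) hn
  have hc1 : c = 1 := by
    have : c * (c * ‖Δ i‖ ^ 2) = c * (1 * ‖Δ i‖ ^ 2) := by linear_combination 2 * hin - hn
    exact mul_right_cancel₀ hi.ne' (mul_left_cancel₀ hc0 this)
  rw [hc1, one_smul] at hc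
  rw [← hc, LinearIsometryEquiv.apply_symm_apply]

/-- An isometry preserving `Φ` moves `δ` by a nonnegative combination of simple roots. -/
theorem repr_delta_sub_nonneg (hΔ : IsSimpleBasis Φ Δ) {g : V ≃ₗᵢ[ℝ] V}
    (hg : ∀ α ∈ Φ, g α ∈ Φ) (k : Fin n) : 0 ≤ Δ.repr (delta Φ Δ - g (delta Φ Δ)) k := by
  classical
  -- Images that are negative roots contribute at most 0; the others are distinct positive roots.
  have key : ∑ β ∈ (posRoots Φ Δ).image g, Δ.repr β k ≤ ∑ β ∈ posRoots Φ Δ, Δ.repr β k := by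
    rw [← Finset.sum_inter_add_sum_sdiff ((posRoots Φ Δ).image g) (posRoots Φ Δ)]
    have h1 : ∑ β ∈ (posRoots Φ Δ).image g \ posRoots Φ Δ, Δ.repr β k ≤ 0 := by
      refine Finset.sum_nonpos fun β hβ => ?_
      rw [Finset.mem_sdiff, Finset.mem_image] at hβ
      obtain ⟨⟨γ, hγ, rfl⟩, hn⟩ := hβ
      have hm := hg γ (mem_posRoots.mp hγ).1
      rcases hΔ.sign _ hm with h | h
      · exact absurd (mem_posRoots.mpr ⟨hm, h⟩) hn
      · exact h k
    have h2 : ∑ β ∈ (posRoots Φ Δ).image g ∩ posRoots Φ Δ, Δ.repr β k ≤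
        ∑ β ∈ posRoots Φ Δ, Δ.repr β k :=
      Finset.sum_le_sum_of_subset_of_nonneg Finset.inter_subset_right
        fun β hβ _ => (mem_posRoots.mp hβ).2 k
    linarith
  rw [Finset.sum_image g.injective.injOn] at key
  simp only [delta, map_sub, map_smul, map_sum, Finsupp.sub_apply, Finsupp.smul_apply,
    Finsupp.coe_finsetSum, Finset.sum_apply, smul_eq_mul]
  linarith

/-- Up to the Coxeter group, an automorphism of `Φ` fixes `δ` and permutes the simple roots. -/
theorem exists_weyl_mul (hΦ : IsRootSystem Φ) (hΔ : IsSimpleBasis Φ Δ) {f : V ≃ₗᵢ[ℝ] V}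
    (hf : ∀ α ∈ Φ, f α ∈ Φ) : ∃ w ∈ weylGroup Φ,
      (w * f) (delta Φ Δ) = delta Φ Δ ∧ ∀ i, ∃ j, (w * f) (Δ i) = Δ j := by
  classical
  have := hΦ.finite_weylGroup
  -- Maximality makes g δ dominant: s_i changes the pairing of g δ with δ by -⟪g δ, Δ i⟫, which
  -- cannot be positive.
  obtain ⟨⟨w, hw⟩, hmax⟩ := Finite.exists_max
    (fun w : weylGroup Φ => ⟪w.1 (f (delta Φ Δ)), delta Φ Δ⟫_ℝ)
  set g := w * f with hgdef
  have hgΦ : ∀ α ∈ Φ, g α ∈ Φ := fun α hα => hΦ.weyl_apply_mem hw (hf α hα)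
  have himg : Φ.image g = Φ := Finset.eq_of_subset_of_card_le
    (fun β hβ => by
      obtain ⟨α, hα, rfl⟩ := Finset.mem_image.mp hβ
      exact hgΦ α hα) (by rw [Finset.card_image_of_injective _ g.injective])
  have hgsymm : ∀ α ∈ Φ, g.symm α ∈ Φ := fun α hα => by
    rw [← himg] at hα
    obtain ⟨β, hβ, rfl⟩ := Finset.mem_image.mp hα
    simpa using hβ
  have hdom : ∀ i, 0 ≤ ⟪g (delta Φ Δ), Δ i⟫_ℝ := fun i => by
    have h := hmax ⟨_, mul_mem (rootReflection_mem_weylGroup (hΔ.mem i)) hw⟩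
    change ⟪rootReflection (Δ i) (g (delta Φ Δ)), delta Φ Δ⟫_ℝ ≤ ⟪g (delta Φ Δ), delta Φ Δ⟫_ℝ at h
    rw [← (rootReflection (Δ i)).inner_map_map, rootReflection_rootReflection,
      rootReflection_delta hΦ hΔ, inner_sub_right] at h
    linarith
  have hdom' : ∀ β ∈ posRoots Φ Δ, 0 ≤ ⟪g (delta Φ Δ), β⟫_ℝ := fun β hβ => by
    rw [← Δ.sum_repr β, inner_sum]
    refine Finset.sum_nonneg fun i _ => ?_
    rw [real_inner_smul_right]
    exact mul_nonneg ((mem_posRoots.mp hβ).2 i) (hdom i)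
  have hsymm : ∀ β ∈ posRoots Φ Δ, g.symm β ∈ posRoots Φ Δ := fun β hβ => by
    have h := hdom' β hβ
    rw [← g.symm.inner_map_map, LinearIsometryEquiv.symm_apply_apply] at h
    rcases mem_or_neg_mem hΦ hΔ (hgsymm β (mem_posRoots.mp hβ).1) with h1 | h1
    · exact h1
    · have := inner_delta_posRoot hΦ hΔ h1
      rw [inner_neg_right] at this
      linarith
  have himgp : (posRoots Φ Δ).image g.symm = posRoots Φ Δ := Finset.eq_of_subset_of_card_le
    (fun β hβ => by
      obtain ⟨α, hα, rfl⟩ := Finset.mem_image.mp hβ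
      exact hsymm α hα) (by rw [Finset.card_image_of_injective _ g.symm.injective])
  have hpos : ∀ β ∈ posRoots Φ Δ, g β ∈ posRoots Φ Δ := fun β hβ => by
    rw [← himgp] at hβ
    obtain ⟨γ, hγ, rfl⟩ := Finset.mem_image.mp hβ
    simpa using hγ
  have hδ : g (delta Φ Δ) = delta Φ Δ := by
    rw [LinearIsometryEquiv.eq_symm_apply _ |>.symm, delta, map_smul, map_sum]
    conv_lhs => rw [← himgp, Finset.sum_image g.symm.injective.injOn]
  exact ⟨w, hw, hδ, exists_simple_of_cone hΦ hΔ hδ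
    (fun i => (mem_posRoots.mp (hpos _ (hΔ.simple_mem_posRoots i))).2)
    (fun i => (mem_posRoots.mp (hsymm _ (hΔ.simple_mem_posRoots i))).2)⟩

/-- An isometry permuting the simple roots preserves `Φ`. -/
theorem map_mem_of_simple (hΦ : IsRootSystem Φ) (hΔ : IsSimpleBasis Φ Δ) {g : V ≃ₗᵢ[ℝ] V}
    (hg : ∀ i, ∃ j, g (Δ i) = Δ j) : ∀ α ∈ Φ, g α ∈ Φ := by
  classical
  have hpos : ∀ α ∈ posRoots Φ Δ, g α ∈ Φ := by
    by_contra! hne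
    obtain ⟨α₀, hα₀, hgα₀⟩ := hne
    -- Minimal counterexample: some Δ i pairs positively with β, and s_i β is then a positive root
    -- of smaller height ⟪δ, ·⟫. It is again a counterexample, because g s_i = s_j g.
    obtain ⟨β, hβ, hmin⟩ := Finset.exists_min_image ((posRoots Φ Δ).filter (fun β => g β ∉ Φ))
      (fun β => ⟪delta Φ Δ, β⟫_ℝ) ⟨α₀, Finset.mem_filter.mpr ⟨hα₀, hgα₀⟩⟩
    obtain ⟨hβ, hgβ⟩ := Finset.mem_filter.mp hβ
    have hβ' := mem_posRoots.mp hβ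
    obtain ⟨i, hi⟩ : ∃ i, 0 < ⟪β, Δ i⟫_ℝ := by
      by_contra! h
      have : ⟪β, β⟫_ℝ ≤ 0 := by
        conv_lhs => rw [← Δ.sum_repr β, sum_inner]
        refine Finset.sum_nonpos fun i _ => ?_
        rw [Δ.sum_repr β, real_inner_smul_left, real_inner_comm]
        exact mul_nonpos_of_nonneg_of_nonpos (hβ'.2 i) (h i)
      rw [real_inner_self_eq_norm_sq] at this
      linarith [hΦ.norm_sq_pos hβ'.1]
    obtain ⟨j, hj⟩ := hg i
    have hne : β ≠ Δ i := by
      rintro rfl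
      exact hgβ (hj ▸ hΔ.mem j)
    have hr := (rootReflection_mem_posRoots hΦ hΔ hβ hne).1
    have hgr : g (rootReflection (Δ i) β) ∉ Φ := fun h => hgβ <| by
      rw [map_rootReflection, hj] at h
      simpa [rootReflection_rootReflection] using hΦ.refl_mem _ (hΔ.mem j) _ h
    have hle := hmin _ (Finset.mem_filter.mpr ⟨hr, hgr⟩)
    have hn := hΦ.norm_sq_pos (hΔ.mem i)
    have : 0 < 2 * ⟪Δ i, β⟫_ℝ / ‖Δ i‖ ^ 2 := by rw [real_inner_comm]; positivity
    rw [rootReflection_apply, inner_sub_right, real_inner_smul_right,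
      inner_delta_simple hΦ hΔ] at hle
    have := mul_pos this (half_pos hn)
    linarith
  intro α hα
  rcases mem_or_neg_mem hΦ hΔ hα with h | h
  · exact hpos α h
  · have := neg_mem hΦ (hpos _ h)
    rwa [map_neg, neg_neg] at this

end IsSimpleBasis

end SimpleRoots

section Invariance

/-! ### Invariance of the permutonestohedron -/

variable {n : ℕ} {Φ : Finset V} {Δ : Module.Basis (Fin n) ℝ V} {G : Set (Submodule ℝ V)}
  {ε : ℕ → ℝ}

theorem finite_fundSubspaces : (fundSubspaces Δ).Finite := by
  refine (Set.finite_range fun I : Set (Fin n) => Submodule.span ℝ (Δ '' I)).subset ?_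
  rintro _ ⟨I, _, rfl⟩
  exact ⟨I, rfl⟩

theorem mem_maximalIn {F : Set (Submodule ℝ V)} {A B : Submodule ℝ V} :
    A ∈ maximalIn F B ↔ Maximal (fun A' => A' ∈ F ∧ A' ≤ B) A :=
  Iff.rfl

theorem finite_maximalIn_fundPart (B : Submodule ℝ V) : (maximalIn (fundPart Δ G) B).Finite :=
  finite_fundSubspaces.subset fun _ hA => (mem_maximalIn.mp hA).prop.1.2

/-- An isometry compatible with `Φ`, `δ`, the simple roots and `G`. -/
structure IsDiagramMap (Φ : Finset V) (Δ : Module.Basis (Fin n) ℝ V) (G : Set (Submodule ℝ V))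
    (g : V ≃ₗᵢ[ℝ] V) : Prop where
  map_root : ∀ α ∈ Φ, g α ∈ Φ
  map_delta : g (delta Φ Δ) = delta Φ Δ
  map_simple : ∀ i, ∃ j, g (Δ i) = Δ j
  map_mem : ∀ A ∈ G, A.map (g.toLinearEquiv : V →ₗ[ℝ] V) ∈ G

theorem map_map_symm (g : V ≃ₗᵢ[ℝ] V) (A : Submodule ℝ V) :
    (A.map (g.symm.toLinearEquiv : V →ₗ[ℝ] V)).map (g.toLinearEquiv : V →ₗ[ℝ] V) = A := by
  rw [← Submodule.map_comp]
  convert Submodule.map_id A using 2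
  ext x
  exact g.apply_symm_apply x

theorem map_symm_map (g : V ≃ₗᵢ[ℝ] V) (A : Submodule ℝ V) :
    (A.map (g.toLinearEquiv : V →ₗ[ℝ] V)).map (g.symm.toLinearEquiv : V →ₗ[ℝ] V) = A :=
  map_map_symm g.symm A

theorem map_le_map_iff (g : V ≃ₗᵢ[ℝ] V) {A B : Submodule ℝ V} :
    A.map (g.toLinearEquiv : V →ₗ[ℝ] V) ≤ B.map (g.toLinearEquiv : V →ₗ[ℝ] V) ↔ A ≤ B :=
  Submodule.map_le_map_iff_of_injective g.injective A B

theorem map_eq_top_iff (g : V ≃ₗᵢ[ℝ] V) {A : Submodule ℝ V} :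
    A.map (g.toLinearEquiv : V →ₗ[ℝ] V) = ⊤ ↔ A = ⊤ := by
  have h : (⊤ : Submodule ℝ V).map (g.toLinearEquiv : V →ₗ[ℝ] V) = ⊤ :=
    (Submodule.map_top _).trans (LinearMap.range_eq_top.mpr g.surjective)
  exact ⟨fun hA => Submodule.map_injective_of_injective g.injective (hA.trans h.symm),
    fun hA => hA ▸ h⟩

theorem map_injective (g : V ≃ₗᵢ[ℝ] V) :
    Function.Injective (Submodule.map (g.toLinearEquiv : V →ₗ[ℝ] V)) :=
  Submodule.map_injective_of_injective g.injective

theorem finrank_map_isometry (g : V ≃ₗᵢ[ℝ] V) (A : Submodule ℝ V) :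
    Module.finrank ℝ (A.map (g.toLinearEquiv : V →ₗ[ℝ] V)) = Module.finrank ℝ A :=
  LinearEquiv.finrank_map_eq g.toLinearEquiv A

theorem deltaVec_eq (A : Submodule ℝ V) : deltaVec Φ Δ A =
    if A = ⊤ then delta Φ Δ else delta Φ Δ - piVec Φ Δ A := by
  rw [deltaVec, piVec]
  split_ifs with h
  · rfl
  · rw [Submodule.starProjection_orthogonal_val]

theorem maximalIn_map {g : V ≃ₗᵢ[ℝ] V} {F : Set (Submodule ℝ V)}
    (hF : ∀ A, A.map (g.toLinearEquiv : V →ₗ[ℝ] V) ∈ F ↔ A ∈ F) (B : Submodule ℝ V) :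
    maximalIn F (B.map (g.toLinearEquiv : V →ₗ[ℝ] V)) =
      Submodule.map (g.toLinearEquiv : V →ₗ[ℝ] V) '' maximalIn F B := by
  have key : ∀ A, A.map (g.toLinearEquiv : V →ₗ[ℝ] V) ∈
      maximalIn F (B.map (g.toLinearEquiv : V →ₗ[ℝ] V)) ↔ A ∈ maximalIn F B := fun A => by
    rw [mem_maximalIn, mem_maximalIn]
    constructor
    · intro h
      refine ⟨⟨(hF A).mp h.prop.1, (map_le_map_iff g).mp h.prop.2⟩, fun C hC hAC => ?_⟩
      exact (map_le_map_iff g).mp (h.le_of_ge ⟨(hF C).mpr hC.1, (map_le_map_iff g).mpr hC.2⟩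
        ((map_le_map_iff g).mpr hAC))
    · intro h
      refine ⟨⟨(hF A).mpr h.prop.1, (map_le_map_iff g).mpr h.prop.2⟩, fun C hC hAC => ?_⟩
      obtain ⟨C, rfl⟩ : ∃ D : Submodule ℝ V, C = D.map (g.toLinearEquiv : V →ₗ[ℝ] V) := ⟨_, (map_map_symm g C).symm⟩
      exact (map_le_map_iff g).mpr (h.le_of_ge
        ⟨(hF C).mp hC.1, (map_le_map_iff g).mp hC.2⟩ ((map_le_map_iff g).mp hAC))
  ext A
  constructor
  · intro hA
    rw [← map_map_symm g A] at hA ⊢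
    exact ⟨_, (key _).mp hA, rfl⟩
  · rintro ⟨A, hA, rfl⟩
    exact (key A).mpr hA

theorem mem_permutonestohedron {x : V} : x ∈ permutonestohedron Φ Δ G ε ↔
    ∀ w ∈ weylGroup Φ, (∀ A ∈ fundPart Δ G, w.symm x ∈ halfSpace Φ Δ ε A) ∧
      ∀ B ∈ fundSubspaces Δ \ fundPart Δ G, w.symm x ∈ halfSpaceBar Φ Δ G ε B := by
  have h : ∀ (w : V ≃ₗᵢ[ℝ] V) (S : Set V), x ∈ w '' S ↔ w.symm x ∈ S := fun w S => by
    constructor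
    · rintro ⟨y, hy, rfl⟩; simpa using hy
    · intro hx; exact ⟨_, hx, w.apply_symm_apply x⟩
  simp only [permutonestohedron, Set.mem_iInter, Set.mem_inter_iff, h]

namespace IsDiagramMap

theorem map_fund {g : V ≃ₗᵢ[ℝ] V} (hg : IsDiagramMap Φ Δ G g) {A : Submodule ℝ V}
    (hA : A ∈ fundSubspaces Δ) :
    A.map (g.toLinearEquiv : V →ₗ[ℝ] V) ∈ fundSubspaces Δ := by
  obtain ⟨I, hI, rfl⟩ := hA
  choose s hs using hg.map_simple
  refine ⟨s '' I, hI.image s, ?_⟩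
  rw [Submodule.map_span, Set.image_image, Set.image_image]
  congr 1
  exact Set.image_congr fun i _ => hs i

variable {g : V ≃ₗᵢ[ℝ] V} (hg : IsDiagramMap Φ Δ G g) (hg' : IsDiagramMap Φ Δ G g.symm)
include hg

theorem piVec_map (A : Submodule ℝ V) :
    piVec Φ Δ (A.map (g.toLinearEquiv : V →ₗ[ℝ] V)) = g (piVec Φ Δ A) := by
  rw [piVec, Submodule.starProjection_map_apply, piVec]
  congr 2
  rw [LinearIsometryEquiv.symm_apply_eq, hg.map_delta]

theorem mem_halfSpace_map {A : Submodule ℝ V} {y : V} (hy : y ∈ halfSpace Φ Δ ε A) :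
    g y ∈ halfSpace Φ Δ ε (A.map (g.toLinearEquiv : V →ₗ[ℝ] V)) := by
  have h : deltaVec Φ Δ (A.map (g.toLinearEquiv : V →ₗ[ℝ] V)) = g (deltaVec Φ Δ A) := by
    simp only [deltaVec_eq, map_eq_top_iff, hg.piVec_map]
    split_ifs
    · exact hg.map_delta.symm
    · rw [map_sub, hg.map_delta]
  simp only [halfSpace, Set.mem_ofPred_eq, h, g.inner_map_map, map_eq_top_iff,
    finrank_map_isometry] at hy ⊢
  exact hy

include hg'

theorem mem_fundSubspaces_iff (A : Submodule ℝ V) :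
    A.map (g.toLinearEquiv : V →ₗ[ℝ] V) ∈ fundSubspaces Δ ↔ A ∈ fundSubspaces Δ :=
  ⟨fun h => map_symm_map g A ▸ hg'.map_fund h, hg.map_fund⟩

theorem mem_fundPart_iff (A : Submodule ℝ V) :
    A.map (g.toLinearEquiv : V →ₗ[ℝ] V) ∈ fundPart Δ G ↔ A ∈ fundPart Δ G :=
  and_congr ⟨fun h => map_symm_map g A ▸ hg'.map_mem _ h, hg.map_mem A⟩
    (hg.mem_fundSubspaces_iff hg' A)

theorem mem_halfSpaceBar_map {B : Submodule ℝ V} {y : V} (hy : y ∈ halfSpaceBar Φ Δ G ε B) :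
    g y ∈ halfSpaceBar Φ Δ G ε (B.map (g.toLinearEquiv : V →ₗ[ℝ] V)) := by
  have hmax := maximalIn_map (hg.mem_fundPart_iff hg') B
  have h : deltaBarVec Φ Δ G (B.map (g.toLinearEquiv : V →ₗ[ℝ] V)) = g (deltaBarVec Φ Δ G B) := by
    rw [deltaBarVec, deltaBarVec, hmax, finsum_mem_image (map_injective g).injOn, map_sub,
      hg.map_delta]
    congr 1
    have := (g.toLinearEquiv.toLinearMap.toAddMonoidHom).map_finsum_mem (piVec Φ Δ)
      (finite_maximalIn_fundPart (Δ := Δ) (G := G) B)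
    refine (finsum_mem_congr rfl fun A _ => hg.piVec_map A).trans this.symm
  simp only [halfSpaceBar, Set.mem_ofPred_eq, h, g.inner_map_map, hmax,
    finsum_mem_image (map_injective g).injOn, finrank_map_isometry] at hy ⊢
  exact hy

/-- As g normalizes W, the condition on g x indexed by w and g A is the condition on x indexed by
g⁻¹ w g and A. -/
theorem mem_permutonestohedron_map {x : V} (hx : x ∈ permutonestohedron Φ Δ G ε) :
    g x ∈ permutonestohedron Φ Δ G ε := by
  rw [mem_permutonestohedron] at hx ⊢
  intro w hw
  have hw' := IsRootSystem.conj_mem_weylGroup hg'.map_root hw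
  have hx' := hx _ hw'
  have e : w.symm (g x) = g ((g.symm * w * g.symm⁻¹).symm x) := by
    change w.symm (g x) = g (g.symm (w.symm (g x)))
    rw [LinearIsometryEquiv.apply_symm_apply]
  refine ⟨fun A hA => ?_, fun B hB => ?_⟩
  · rw [e, ← map_map_symm g A]
    rw [← map_map_symm g A, hg.mem_fundPart_iff hg'] at hA
    exact hg.mem_halfSpace_map (hx'.1 _ hA)
  · rw [e, ← map_map_symm g B]
    rw [← map_map_symm g B, Set.mem_sdiff, hg.mem_fundPart_iff hg',
      hg.mem_fundSubspaces_iff hg'] at hB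
    exact hg.mem_halfSpaceBar_map hg' (hx'.2 _ hB)

end IsDiagramMap

theorem weyl_mem_permutonestohedron {w : V ≃ₗᵢ[ℝ] V} (hw : w ∈ weylGroup Φ) {x : V}
    (hx : x ∈ permutonestohedron Φ Δ G ε) : w x ∈ permutonestohedron Φ Δ G ε := by
  rw [mem_permutonestohedron] at hx ⊢
  intro u hu
  exact hx (w⁻¹ * u) (mul_mem (inv_mem hw) hu)

/-- Automorphisms of `Φ` preserve the permutonestohedron. -/
theorem rootAut_mem_permutonestohedron (hΦ : IsRootSystem Φ) (hnorm : IsNormalized Φ)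
    (hΔ : IsSimpleBasis Φ Δ)
    (hGinv : ∀ f ∈ rootAut Φ, ∀ A ∈ G, A.map (f : V →ₗ[ℝ] V) ∈ G)
    {f : V ≃ₗ[ℝ] V} (hf : f ∈ rootAut Φ) {x : V} (hx : x ∈ permutonestohedron Φ Δ G ε) :
    f x ∈ permutonestohedron Φ Δ G ε := by
  set F : V ≃ₗᵢ[ℝ] V := f.isometryOfInner (hΦ.inner_map_map hnorm hf) with hF
  obtain ⟨w, hw, hδ, hs⟩ :=
    IsSimpleBasis.exists_weyl_mul hΦ hΔ (f := F) fun α hα => IsRootSystem.map_mem hf hα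
  set g := w * F with hgdef
  have hgmem : g.toLinearEquiv ∈ rootAut Φ := mul_mem (hΦ.weyl_mem_root hw) hf
  have hgmem' : g.symm.toLinearEquiv ∈ rootAut Φ := IsRootSystem.symm_mem_rootAut hgmem
  have hg : IsDiagramMap Φ Δ G g :=
    ⟨fun α hα => IsRootSystem.map_mem hgmem hα, hδ, hs, hGinv _ hgmem⟩
  have hg' : IsDiagramMap Φ Δ G g.symm := by
    refine ⟨fun α hα => IsRootSystem.map_mem hgmem' hα, ?_, fun j => ?_, hGinv _ hgmem'⟩
    · rw [LinearIsometryEquiv.symm_apply_eq, hδ]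
    · choose s hs using hs
      have hinj : Function.Injective s := fun i j hij =>
        Δ.injective (g.injective (by rw [hs, hs, hij]))
      obtain ⟨i, rfl⟩ := (Finite.injective_iff_surjective.mp hinj) j
      exact ⟨i, by rw [LinearIsometryEquiv.symm_apply_eq, hs]⟩
  have h := weyl_mem_permutonestohedron (inv_mem hw) (hg.mem_permutonestohedron_map hg' hx)
  have e : (w⁻¹ : V ≃ₗᵢ[ℝ] V) (g x) = f x := w.symm_apply_apply (F x)
  rwa [e] at h

end Invariance

section Coefficients

/-! ### The coefficients of `π_A` -/

variable {n : ℕ} {Φ : Finset V} {Δ : Module.Basis (Fin n) ℝ V} {G : Set (Submodule ℝ V)}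
  {ε : ℕ → ℝ}

/-- The subspace spanned by the simple roots with index in `I`. -/
def fundSpan (Δ : Module.Basis (Fin n) ℝ V) (I : Finset (Fin n)) : Submodule ℝ V :=
  Submodule.span ℝ (Δ '' (I : Set (Fin n)))

theorem mem_fundSubspaces {A : Submodule ℝ V} :
    A ∈ fundSubspaces Δ ↔ ∃ I : Finset (Fin n), I.Nonempty ∧ A = fundSpan Δ I := by
  classical
  constructor
  · rintro ⟨I, hI, rfl⟩
    exact ⟨I.toFinset, by simpa using hI, by simp [fundSpan]⟩
  · rintro ⟨I, hI, rfl⟩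
    exact ⟨I, hI, rfl⟩

theorem repr_eq_zero_of_mem_fundSpan {I : Finset (Fin n)} {v : V} (hv : v ∈ fundSpan Δ I)
    {i : Fin n} (hi : i ∉ I) : Δ.repr v i = 0 := by
  rw [fundSpan, Module.Basis.mem_span_image] at hv
  by_contra h
  exact hi (hv (Finsupp.mem_support_iff.mpr h))

theorem simple_mem_fundSpan {I : Finset (Fin n)} {i : Fin n} : Δ i ∈ fundSpan Δ I ↔ i ∈ I := by
  refine ⟨fun h => ?_, fun h => Submodule.subset_span ⟨i, h, rfl⟩⟩
  by_contra hi
  simpa using repr_eq_zero_of_mem_fundSpan h hi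

theorem finrank_fundSpan (I : Finset (Fin n)) : Module.finrank ℝ (fundSpan Δ I) = I.card := by
  have h := finrank_span_eq_card (R := ℝ) (b := fun i : I => Δ i)
    (Δ.linearIndependent.comp _ Subtype.val_injective)
  rw [Fintype.card_coe] at h
  have hr : Set.range (fun i : I => Δ i) = Δ '' (I : Set (Fin n)) := by ext x; simp
  rw [← h, fundSpan, hr]

theorem fundSpan_univ : fundSpan Δ Finset.univ = ⊤ := by
  rw [fundSpan, Finset.coe_univ, Set.image_univ, Δ.span_eq]

theorem fundSpan_eq_top_iff {I : Finset (Fin n)} : fundSpan Δ I = ⊤ ↔ I = Finset.univ := by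
  refine ⟨fun h => Finset.eq_univ_iff_forall.mpr fun i => ?_, fun h => h ▸ fundSpan_univ⟩
  rw [← simple_mem_fundSpan (Δ := Δ), h]
  trivial

theorem piVec_mem (A : Submodule ℝ V) : piVec Φ Δ A ∈ A :=
  Submodule.starProjection_apply_mem _ _

theorem piVec_top : piVec Φ Δ ⊤ = delta Φ Δ :=
  Submodule.starProjection_eq_self_iff.mpr trivial

theorem piVec_fundSpan_eq {I : Finset (Fin n)} {v : V} (hv : v ∈ fundSpan Δ I)
    (h : ∀ i ∈ I, ⟪delta Φ Δ - v, Δ i⟫_ℝ = 0) : piVec Φ Δ (fundSpan Δ I) = v := by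
  refine Submodule.eq_starProjection_of_mem_orthogonal hv ?_
  rw [Submodule.mem_orthogonal']
  intro u hu
  induction hu using Submodule.span_induction with
  | mem x hx =>
    obtain ⟨i, hi, rfl⟩ := hx
    exact h i hi
  | zero => simp
  | add x y _ _ hx hy => rw [inner_add_right, hx, hy, add_zero]
  | smul c x _ hx => rw [real_inner_smul_right, hx, mul_zero]

open Classical in
/-- `π_A` is half the sum of the positive roots in `A`. -/
theorem piVec_fundSpan (hΦ : IsRootSystem Φ) (hΔ : IsSimpleBasis Φ Δ) (I : Finset (Fin n)) :
    piVec Φ Δ (fundSpan Δ I) =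
      (1 / 2 : ℝ) • ∑ β ∈ (posRoots Φ Δ).filter (· ∈ fundSpan Δ I), β := by
  refine piVec_fundSpan_eq (Submodule.smul_mem _ _ (Submodule.sum_mem _ fun β hβ =>
    (Finset.mem_filter.mp hβ).2)) fun i hi => ?_
  have hsi := simple_mem_fundSpan (Δ := Δ).mpr hi
  -- The positive roots outside the span are permuted by s_i, since Δ i lies in the span; their sum
  -- is therefore orthogonal to Δ i.
  rw [delta, ← smul_sub, ← Finset.sum_filter_add_sum_filter_not (posRoots Φ Δ)
    (· ∈ fundSpan Δ I), add_sub_cancel_left, real_inner_smul_left,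
    IsSimpleBasis.inner_sum_eq_zero (hΦ.ne_zero (hΔ.mem i)), mul_zero]
  intro β hβ
  rw [Finset.mem_filter] at hβ ⊢
  refine ⟨(IsSimpleBasis.rootReflection_mem_posRoots hΦ hΔ hβ.1 ?_).1, fun h => hβ.2 ?_⟩
  · rintro rfl
    exact hβ.2 hsi
  · rw [rootReflection_apply] at h
    have := Submodule.add_mem _ h (Submodule.smul_mem _ (2 * ⟪Δ i, β⟫_ℝ / ‖Δ i‖ ^ 2) hsi)
    rwa [sub_add_cancel] at this

/-- Δ i is one of the positive roots summed in π_A, and the others have nonnegative coefficients.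
The bound keeps the denominators `minCoeff` positive. -/
theorem half_le_coeff (hΦ : IsRootSystem Φ) (hΔ : IsSimpleBasis Φ Δ) {I : Finset (Fin n)}
    {i : Fin n} (hi : i ∈ I) : 1 / 2 ≤ Δ.repr (piVec Φ Δ (fundSpan Δ I)) i := by
  classical
  rw [piVec_fundSpan hΦ hΔ, map_smul, Finsupp.smul_apply, map_sum, Finsupp.coe_finsetSum,
    Finset.sum_apply, smul_eq_mul]
  have h := Finset.single_le_sum (f := fun β => Δ.repr β i)
    (s := (posRoots Φ Δ).filter (· ∈ fundSpan Δ I))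
    (fun β hβ => (mem_posRoots.mp (Finset.mem_filter.mp hβ).1).2 i)
    (Finset.mem_filter.mpr ⟨hΔ.simple_mem_posRoots i, simple_mem_fundSpan.mpr hi⟩)
  simp only [Module.Basis.repr_self, Finsupp.single_eq_same] at h
  linarith

theorem inner_piVec (I : Finset (Fin n)) (x : V) : ⟪x, piVec Φ Δ (fundSpan Δ I)⟫_ℝ =
    ∑ i ∈ I, Δ.repr (piVec Φ Δ (fundSpan Δ I)) i * ⟪x, Δ i⟫_ℝ := by
  conv_lhs => rw [← Δ.sum_repr (piVec Φ Δ (fundSpan Δ I)), inner_sum]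
  simp only [real_inner_smul_right]
  refine (Finset.sum_subset (Finset.subset_univ I) fun i _ hi => ?_).symm
  rw [repr_eq_zero_of_mem_fundSpan (piVec_mem _) hi, zero_mul]

/-- Projecting δ then only truncates its expansion. This is the case of `pow_mul_coeff_le` in which
I cannot be enlarged. -/
theorem coeff_eq_of_orthogonal {I : Finset (Fin n)}
    (h : ∀ i ∈ I, ∀ j ∉ I, ⟪Δ i, Δ j⟫_ℝ = 0) {i : Fin n} (hi : i ∈ I) :
    Δ.repr (piVec Φ Δ (fundSpan Δ I)) i = Δ.repr (delta Φ Δ) i := by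
  classical
  have hδ := Finset.sum_add_sum_compl I fun i => Δ.repr (delta Φ Δ) i • Δ i
  rw [Δ.sum_repr] at hδ
  have key : piVec Φ Δ (fundSpan Δ I) = ∑ j ∈ I, Δ.repr (delta Φ Δ) j • Δ j := by
    refine piVec_fundSpan_eq (Submodule.sum_mem _ fun j hj =>
      Submodule.smul_mem _ _ (simple_mem_fundSpan.mpr hj)) fun k hk => ?_
    rw [sub_eq_iff_eq_add'.mpr hδ.symm, sum_inner]
    refine Finset.sum_eq_zero fun j hj => ?_
    rw [real_inner_smul_left, real_inner_comm, h k hk j (Finset.mem_compl.mp hj), mul_zero]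
  rw [key, map_sum, Finsupp.coe_finsetSum, Finset.sum_apply, Finset.sum_eq_single_of_mem i hi]
  · simp
  · intro j _ hj
    simp [Finsupp.single_eq_of_ne hj.symm]

/-! ### Growing the members of a building set -/

theorem finite_rootSubspaces : (rootSubspaces Φ).Finite := by
  refine ((Φ.finite_toSet.finite_subsets).image (Submodule.span ℝ)).subset ?_
  rintro _ ⟨T, hT, _, rfl⟩
  exact ⟨T, hT, rfl⟩

theorem IsBuildingSet.exists_maximalIn (hG : IsBuildingSet Φ G) {A C : Submodule ℝ V}
    (hA : A ∈ G) (hAC : A ≤ C) : ∃ M ∈ maximalIn G C, A ≤ M := by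
  have hfin : {A' | A' ∈ G ∧ A' ≤ C}.Finite :=
    finite_rootSubspaces.subset fun B hB => hG.subset hB.1
  obtain ⟨M, hAM, hM⟩ := hfin.exists_le_maximal (show A ∈ {A' | A' ∈ G ∧ A' ≤ C} from ⟨hA, hAC⟩)
  exact ⟨M, hM, hAM⟩

/-- A member of `G` together with a simple root not orthogonal to it spans a member of `G`. -/
theorem fundSpan_insert_mem (hΦ : IsRootSystem Φ) (hΔ : IsSimpleBasis Φ Δ)
    (hG : IsBuildingSet Φ G) {I : Finset (Fin n)} (hI : fundSpan Δ I ∈ G) {k j : Fin n}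
    (hk : k ∈ I) (hj : j ∉ I) (hkj : ⟪Δ k, Δ j⟫_ℝ ≠ 0) : fundSpan Δ (insert j I) ∈ G := by
  set C := fundSpan Δ (insert j I) with hC
  have hIC : fundSpan Δ I ≤ C := Submodule.span_mono
    (Set.image_mono (Finset.coe_subset.mpr (Finset.subset_insert _ _)))
  have hjC : Δ j ∈ C := simple_mem_fundSpan.mpr (Finset.mem_insert_self _ _)
  have hkI : Δ k ∈ fundSpan Δ I := simple_mem_fundSpan.mpr hk
  have hCΦ : C ∈ rootSubspaces Φ := by
    refine ⟨Δ '' (↑(insert j I) : Set (Fin n)), ?_, ?_, rfl⟩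
    · rintro _ ⟨i, _, rfl⟩
      exact hΔ.mem i
    · exact ⟨_, j, by simp, rfl⟩
  obtain ⟨M, hM, hIM⟩ := hG.exists_maximalIn hI hIC
  have hMmax := mem_maximalIn.mp hM
  have hsup : ∀ {L : Submodule ℝ V}, L ∈ maximalIn G C → L ≠ M → Disjoint L M := fun hL hne =>
    (hG.indep C hCΦ hL).mono_right (le_sSup (Set.mem_sdiff_singleton.mpr ⟨hM, hne.symm⟩))
  by_cases hjM : Δ j ∈ M
  · have : M = C := by
      refine le_antisymm hMmax.prop.2 (Submodule.span_le.mpr ?_)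
      rintro _ ⟨i, hi, rfl⟩
      rcases Finset.mem_insert.mp (Finset.mem_coe.mp hi) with rfl | hi
      · exact hjM
      · exact hIM (simple_mem_fundSpan.mpr hi)
    exact this ▸ hMmax.prop.1
  -- The summands M ∋ Δ k, M₁ ∋ Δ j and M₂ ∋ γ, with M₁ and M₂ different from M, contradict
  -- directness through Δ j = γ + c Δ k, whether or not M₁ = M₂.
  exfalso
  set γ := rootReflection (Δ k) (Δ j) with hγ
  set c := 2 * ⟪Δ k, Δ j⟫_ℝ / ‖Δ k‖ ^ 2 with hc
  have hc0 : c ≠ 0 := div_ne_zero (mul_ne_zero two_ne_zero hkj) (hΦ.norm_sq_pos (hΔ.mem k)).ne'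
  have hγeq : γ = Δ j - c • Δ k := rootReflection_apply _ _
  have hγΦ : γ ∈ Φ := hΦ.refl_mem _ (hΔ.mem k) _ (hΔ.mem j)
  have hγC : γ ∈ C := hγeq ▸ Submodule.sub_mem _ hjC (Submodule.smul_mem _ _ (hIC hkI))
  have hγM : γ ∉ M := fun h => hjM <| by
    have := Submodule.add_mem _ h (Submodule.smul_mem _ c (hIM hkI))
    rwa [hγeq, sub_add_cancel] at this
  obtain ⟨M₁, hM₁, hjM₁⟩ := hG.exists_maximalIn (hG.line_mem _ (hΔ.mem j))
    ((Submodule.span_singleton_le_iff_mem _ _).mpr hjC)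
  obtain ⟨M₂, hM₂, hγM₂⟩ := hG.exists_maximalIn (hG.line_mem _ hγΦ)
    ((Submodule.span_singleton_le_iff_mem _ _).mpr hγC)
  rw [Submodule.span_singleton_le_iff_mem] at hjM₁ hγM₂
  have hne₁ : M₁ ≠ M := fun h => hjM (h ▸ hjM₁)
  have hne₂ : M₂ ≠ M := fun h => hγM (h ▸ hγM₂)
  by_cases h12 : M₂ = M₁
  · have hk₁ : Δ k ∈ M₁ := by
      have : Δ k = c⁻¹ • (Δ j - γ) := by rw [hγeq, sub_sub_cancel, inv_smul_smul₀ hc0]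
      rw [this]
      exact Submodule.smul_mem _ _ (Submodule.sub_mem _ hjM₁ (h12 ▸ hγM₂))
    exact hΦ.ne_zero (hΔ.mem k) (Submodule.disjoint_def.mp (hsup hM₁ hne₁) _ hk₁ (hIM hkI))
  · have hd : Disjoint M₁ (M₂ ⊔ M) := (hG.indep C hCΦ hM₁).mono_right
      (sup_le (le_sSup (Set.mem_sdiff_singleton.mpr ⟨hM₂, h12⟩))
        (le_sSup (Set.mem_sdiff_singleton.mpr ⟨hM, hne₁.symm⟩)))
    refine hΦ.ne_zero (hΔ.mem j) (Submodule.disjoint_def.mp hd _ hjM₁ ?_)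
    rw [show Δ j = γ + c • Δ k by rw [hγeq, sub_add_cancel]]
    exact Submodule.add_mem_sup hγM₂ (Submodule.smul_mem _ _ (hIM hkI))

/-! ### Suitable lists -/

theorem bddAbove_ratio (i j : ℕ) :
    BddAbove (insert 1 {r | ∃ A ∈ fundPart Δ G, ∃ B ∈ fundPart Δ G, B < A ∧
    Module.finrank ℝ A = i ∧ Module.finrank ℝ B = j ∧ r = maxCoeff Φ Δ A / minCoeff Φ Δ B}) := by
  refine Set.Finite.bddAbove (Set.Finite.insert _ ?_)
  have hfin : (fundPart Δ G).Finite := finite_fundSubspaces.subset Set.inter_subset_right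
  refine ((hfin.prod hfin).image fun p => maxCoeff Φ Δ p.1 / minCoeff Φ Δ p.2).subset ?_
  rintro _ ⟨A, hA, B, hB, _, _, _, rfl⟩
  exact ⟨(A, B), ⟨hA, hB⟩, rfl⟩

theorem one_le_ratio (i j : ℕ) : 1 ≤ ratio Φ Δ G i j :=
  le_csSup (bddAbove_ratio i j) (Set.mem_insert _ _)

/-- Coefficient ≤ maximum ≤ R · minimum ≤ R · coefficient. -/
theorem coeff_le_ratio_mul (hΦ : IsRootSystem Φ) (hΔ : IsSimpleBasis Φ Δ)
    {I J : Finset (Fin n)} (hIJ : I ⊂ J) (hI : fundSpan Δ I ∈ G) (hJ : fundSpan Δ J ∈ G)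
    {i : Fin n} (hi : i ∈ I) :
    Δ.repr (piVec Φ Δ (fundSpan Δ J)) i ≤
      ratio Φ Δ G J.card I.card * Δ.repr (piVec Φ Δ (fundSpan Δ I)) i := by
  have hmax : Δ.repr (piVec Φ Δ (fundSpan Δ J)) i ≤ maxCoeff Φ Δ (fundSpan Δ J) :=
    le_ciSup (f := fun i : {i : Fin n // Δ i ∈ fundSpan Δ J} =>
      Δ.repr (piVec Φ Δ (fundSpan Δ J)) i) (Set.finite_range _).bddAbove
      ⟨i, simple_mem_fundSpan.mpr (hIJ.1 hi)⟩
  have hmin : minCoeff Φ Δ (fundSpan Δ I) ≤ Δ.repr (piVec Φ Δ (fundSpan Δ I)) i :=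
    ciInf_le (f := fun i : {i : Fin n // Δ i ∈ fundSpan Δ I} =>
      Δ.repr (piVec Φ Δ (fundSpan Δ I)) i) (Set.finite_range _).bddBelow
      ⟨i, simple_mem_fundSpan.mpr hi⟩
  have hpos : 1 / 2 ≤ minCoeff Φ Δ (fundSpan Δ I) := by
    have : Nonempty {i : Fin n // Δ i ∈ fundSpan Δ I} := ⟨⟨i, simple_mem_fundSpan.mpr hi⟩⟩
    exact le_ciInf fun k => half_le_coeff hΦ hΔ (simple_mem_fundSpan.mp k.2)
  have hlt : fundSpan Δ I < fundSpan Δ J := by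
    refine lt_of_le_of_ne (Submodule.span_mono (Set.image_mono (Finset.coe_subset.mpr hIJ.1)))
      fun h => ?_
    have := congrArg (fun A : Submodule ℝ V => Module.finrank ℝ A) h
    simp only [finrank_fundSpan] at this
    exact (Finset.card_lt_card hIJ).ne this
  have hr : maxCoeff Φ Δ (fundSpan Δ J) / minCoeff Φ Δ (fundSpan Δ I) ≤
      ratio Φ Δ G J.card I.card := by
    refine le_csSup (bddAbove_ratio _ _) (Set.mem_insert_of_mem _ ?_)
    exact ⟨_, ⟨hJ, mem_fundSubspaces.mpr ⟨J, ⟨i, hIJ.1 hi⟩, rfl⟩⟩, _,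
      ⟨hI, mem_fundSubspaces.mpr ⟨I, ⟨i, hi⟩, rfl⟩⟩, hlt, finrank_fundSpan J,
      finrank_fundSpan I, rfl⟩
  rw [div_le_iff₀ (by linarith)] at hr
  refine hmax.trans (hr.trans (mul_le_mul_of_nonneg_left hmin ?_))
  linarith [one_le_ratio (Φ := Φ) (Δ := Δ) (G := G) J.card I.card]

theorem IsSuitable.two_mul_lt (hε : IsSuitable Φ Δ G ε) {i : ℕ} (hi : 1 ≤ i) (hin : i < n) :
    2 * ε i < ε (i + 1) := by
  have h := hε.ratio_lt (i + 1) (by omega) hin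
  have h1 := one_le_ratio (Φ := Φ) (Δ := Δ) (G := G) (i + 1) i
  have h2 := hε.pos i hi hin.le
  rw [Nat.add_sub_cancel] at h
  nlinarith

theorem IsSuitable.pow_mul_le (hε : IsSuitable Φ Δ G ε) {i : ℕ} (hi : 1 ≤ i) (k : ℕ)
    (hk : i + k ≤ n) : 2 ^ k * ε i ≤ ε (i + k) ∧ (0 < k → 2 ^ k * ε i < ε (i + k)) := by
  induction k with
  | zero => simp
  | succ k ih =>
    have h1 := (ih (by omega)).1
    have h2 := hε.two_mul_lt (i := i + k) (by omega) (by omega)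
    have : 2 ^ (k + 1) * ε i < ε (i + (k + 1)) := by
      rw [pow_succ, ← add_assoc]; linarith
    exact ⟨this.le, fun _ => this⟩

/-- The comparison between the coefficients of `π_A` and of `δ` along a suitable list. -/
theorem pow_mul_coeff_le (hΦ : IsRootSystem Φ) (hΔ : IsSimpleBasis Φ Δ) (hG : IsBuildingSet Φ G)
    (hε : IsSuitable Φ Δ G ε) (k : ℕ) {I : Finset (Fin n)} (hI : fundSpan Δ I ∈ G)
    (hk : I.card + k = n) {i : Fin n} (hi : i ∈ I) :
    2 ^ k * Δ.repr (delta Φ Δ) i * ε I.card ≤ Δ.repr (piVec Φ Δ (fundSpan Δ I)) i * ε n ∧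
      (0 < k → 2 ^ k * Δ.repr (delta Φ Δ) i * ε I.card <
        Δ.repr (piVec Φ Δ (fundSpan Δ I)) i * ε n) := by
  induction k generalizing I with
  | zero =>
    have : I = Finset.univ := Finset.card_eq_iff_eq_univ I |>.mp (by simpa using hk)
    subst this
    rw [fundSpan_univ, piVec_top]
    simp
  | succ k ih =>
    have hc1 : 1 ≤ I.card := Finset.card_pos.mpr ⟨i, hi⟩
    have hp := half_le_coeff hΦ hΔ hi
    suffices h : 2 ^ (k + 1) * Δ.repr (delta Φ Δ) i * ε I.card <
        Δ.repr (piVec Φ Δ (fundSpan Δ I)) i * ε n from ⟨h.le, fun _ => h⟩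
    -- If I is orthogonal to the remaining simple roots, doubling of ε suffices. Otherwise a
    -- neighbouring simple root gives a member of G of codimension one less.
    by_cases h : ∀ i ∈ I, ∀ j ∉ I, ⟪Δ i, Δ j⟫_ℝ = 0
    · rw [← coeff_eq_of_orthogonal h hi]
      have := (hε.pow_mul_le hc1 (k + 1) hk.le).2 k.succ_pos
      rw [hk] at this
      nlinarith
    · push Not at h
      obtain ⟨l, hl, j, hj, hlj⟩ := h
      have hJ := fundSpan_insert_mem hΦ hΔ hG hI hl hj hlj
      have hcard : (insert j I).card = I.card + 1 := Finset.card_insert_of_notMem hj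
      have h1 := (ih hJ (by omega) (Finset.mem_insert_of_mem hi)).1
      have h2 := coeff_le_ratio_mul hΦ hΔ (Finset.ssubset_insert hj) hI hJ hi
      have h3 := hε.ratio_lt (I.card + 1) (by omega) (by omega)
      rw [Nat.add_sub_cancel] at h3
      rw [hcard] at h1 h2
      have hεp := hε.pos _ hc1 (by omega)
      have hεp' := hε.pos (I.card + 1) (by omega) (by omega)
      have hεn := hε.pos n (by omega) le_rfl
      have hpj := half_le_coeff hΦ hΔ (Finset.mem_insert_of_mem hi : i ∈ insert j I)
      set R := ratio Φ Δ G (I.card + 1) I.card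
      set p := Δ.repr (piVec Φ Δ (fundSpan Δ I)) i
      set q := Δ.repr (piVec Φ Δ (fundSpan Δ (insert j I))) i
      set c := Δ.repr (delta Φ Δ) i
      -- Adding one root costs a factor R in the coefficient; suitability absorbs it and leaves the
      -- extra 2.
      have h4 : 2 * ε I.card * (q * ε n) < p * ε n * ε (I.card + 1) := by
        calc 2 * ε I.card * (q * ε n) ≤ 2 * ε I.card * (R * p * ε n) := by gcongr
          _ = (p * ε n) * (2 * R * ε I.card) := by ring
          _ < (p * ε n) * ε (I.card + 1) := by
            have : 0 < p * ε n := mul_pos (by linarith) hεn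
            gcongr
      have h5 := mul_le_mul_of_nonneg_left h1 (by positivity : 0 ≤ 2 * ε I.card)
      refine lt_of_mul_lt_mul_right ?_ hεp'.le
      calc 2 ^ (k + 1) * c * ε I.card * ε (I.card + 1)
          = 2 * ε I.card * (2 ^ k * c * ε (I.card + 1)) := by ring
        _ ≤ _ := h5
        _ < _ := h4

end Coefficients

section Nestohedra

/-! ### The nestohedron -/

variable {n : ℕ} {Φ : Finset V} {Δ : Module.Basis (Fin n) ℝ V} {G : Set (Submodule ℝ V)}
  {ε : ℕ → ℝ}

/-- On H_V the pairing with δ is constant, so upper bounds for δ - π_A become lower bounds for π_A.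
-/
theorem mem_nestohedron {x : V} : x ∈ nestohedron Φ Δ G ε ↔ ⟪x, delta Φ Δ⟫_ℝ = ε n ∧
    ∀ I : Finset (Fin n), I.Nonempty → fundSpan Δ I ∈ G → I ≠ Finset.univ →
      ε I.card ≤ ⟪x, piVec Φ Δ (fundSpan Δ I)⟫_ℝ := by
  have h : ∀ I : Finset (Fin n), I ≠ Finset.univ → ⟪x, delta Φ Δ⟫_ℝ = ε n →
      (x ∈ halfSpace Φ Δ ε (fundSpan Δ I) ↔ ε I.card ≤ ⟪x, piVec Φ Δ (fundSpan Δ I)⟫_ℝ) := by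
    intro I hI hx
    have hI' : fundSpan Δ I ≠ ⊤ := fun h => hI (fundSpan_eq_top_iff.mp h)
    simp only [halfSpace, Set.mem_ofPred_eq, deltaVec_eq, if_neg hI', inner_sub_right, hx,
      finrank_fundSpan, sub_le_sub_iff_left]
  rw [nestohedron, Set.mem_inter_iff, hyperplaneTop, Set.mem_ofPred_eq, Set.mem_iInter₂]
  refine and_congr_right fun hx => ⟨fun H I hne hI hI' => (h I hI' hx).mp (H _ ⟨⟨hI, ?_⟩, ?_⟩), ?_⟩
  · exact mem_fundSubspaces.mpr ⟨I, hne, rfl⟩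
  · exact fun h => hI' (fundSpan_eq_top_iff.mp h)
  · rintro H A ⟨⟨hA, hA'⟩, hA''⟩
    obtain ⟨I, hne, rfl⟩ := mem_fundSubspaces.mp hA'
    have hI' : I ≠ Finset.univ := fun h => hA'' (fundSpan_eq_top_iff.mpr h)
    exact (h I hI' hx).mpr (H I hne hA hI')

theorem pos_rank (hΦ : IsRootSystem Φ) (Δ : Module.Basis (Fin n) ℝ V) (hG : IsBuildingSet Φ G)
    (hV : ⊤ ∈ G) : 0 < n := by
  rcases Nat.eq_zero_or_pos n with rfl | h
  · obtain ⟨T, hT, ⟨α, hα⟩, -⟩ := hG.subset hV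
    refine absurd (hΦ.ne_zero (hT hα)) (not_not_intro ?_)
    rw [← Δ.sum_repr α, Finset.univ_eq_empty, Finset.sum_empty]
  · exact h

theorem coeff_delta_pos (hΦ : IsRootSystem Φ) (hΔ : IsSimpleBasis Φ Δ) (i : Fin n) :
    1 / 2 ≤ Δ.repr (delta Φ Δ) i := by
  have := half_le_coeff hΦ hΔ (Finset.mem_univ i)
  rwa [fundSpan_univ, piVec_top] at this

theorem inner_delta (x : V) :
    ⟪x, delta Φ Δ⟫_ℝ = ∑ i, Δ.repr (delta Φ Δ) i * ⟪x, Δ i⟫_ℝ := by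
  have := inner_piVec (Φ := Φ) (Δ := Δ) Finset.univ x
  rwa [fundSpan_univ, piVec_top] at this

/-- The nestohedron lies in the closed fundamental chamber. -/
theorem inner_simple_nonneg (hΦ : IsRootSystem Φ) (hΔ : IsSimpleBasis Φ Δ)
    (hG : IsBuildingSet Φ G) (hε : IsSuitable Φ Δ G ε) {x : V} (hx : x ∈ nestohedron Φ Δ G ε)
    (i : Fin n) : 0 ≤ ⟪x, Δ i⟫_ℝ := by
  rw [mem_nestohedron] at hx
  have hn : 0 < n := i.pos
  have hmem : fundSpan Δ {i} ∈ G := by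
    have := hG.line_mem _ (hΔ.mem i)
    rwa [fundSpan, Finset.coe_singleton, Set.image_singleton]
  have h : 0 ≤ ⟪x, piVec Φ Δ (fundSpan Δ {i})⟫_ℝ := by
    -- For n = 1 the line is V itself and carries no half-space; the equation of H_V replaces it.
    by_cases hi : ({i} : Finset (Fin n)) = Finset.univ
    · rw [hi, fundSpan_univ, piVec_top, hx.1]
      exact (hε.pos n hn le_rfl).le
    · refine le_trans ?_ (hx.2 {i} (Finset.singleton_nonempty i) hmem hi)
      rw [Finset.card_singleton]
      exact (hε.pos 1 le_rfl hn).le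
  rw [inner_piVec, Finset.sum_singleton] at h
  have := half_le_coeff hΦ hΔ (Finset.mem_singleton_self i)
  exact nonneg_of_mul_nonneg_right h (by linarith)

/-- The numbers ⟪x, Δ i⟫ are nonnegative and sum to ε n with weights at least 1/2, so each is at
most 2 ε n. Expanding one factor of ⟪x, x⟫ then bounds ‖x‖. -/
theorem exists_norm_le_of_mem_nestohedron (hΦ : IsRootSystem Φ) (hΔ : IsSimpleBasis Φ Δ)
    (hG : IsBuildingSet Φ G) (hε : IsSuitable Φ Δ G ε) :
    ∃ K : ℝ, ∀ x ∈ nestohedron Φ Δ G ε, ‖x‖ ≤ K := by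
  have hcont : ∀ i, ∃ C : ℝ, ∀ x, |Δ.repr x i| ≤ C * ‖x‖ := fun i => by
    let φ := LinearMap.toContinuousLinearMap (Δ.coord i)
    exact ⟨‖φ‖, fun x => φ.le_opNorm x⟩
  choose C hC using hcont
  refine ⟨∑ i, C i * (2 * ε n), fun x hx => ?_⟩
  have hnn := inner_simple_nonneg hΦ hΔ hG hε hx
  have hle : ∀ i, ⟪x, Δ i⟫_ℝ ≤ 2 * ε n := fun i => by
    have h := (mem_nestohedron.mp hx).1
    rw [inner_delta] at h
    have h1 := Finset.single_le_sum (f := fun i => Δ.repr (delta Φ Δ) i * ⟪x, Δ i⟫_ℝ)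
      (fun j _ => mul_nonneg (by linarith [coeff_delta_pos hΦ hΔ j]) (hnn j)) (Finset.mem_univ i)
    rw [h] at h1
    have := mul_le_mul_of_nonneg_right (coeff_delta_pos hΦ hΔ i) (hnn i)
    linarith
  rcases (norm_nonneg x).eq_or_lt with h0 | h0
  · rw [← h0]
    refine Finset.sum_nonneg fun i _ => mul_nonneg ?_ ((hnn i).trans (hle i))
    have := hC i (Δ i)
    rw [Module.Basis.repr_self, Finsupp.single_eq_same, abs_one] at this
    exact (pos_of_mul_pos_left (one_pos.trans_le this) (norm_nonneg _)).le
  · refine le_of_mul_le_mul_right ?_ h0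
    calc ‖x‖ * ‖x‖ = ∑ i, Δ.repr x i * ⟪x, Δ i⟫_ℝ := by
          rw [← real_inner_self_eq_norm_mul_norm]
          conv_lhs => rw [← Δ.sum_repr x, inner_sum]
          simp only [Δ.sum_repr, real_inner_smul_right]
      _ ≤ ∑ i, C i * ‖x‖ * (2 * ε n) := Finset.sum_le_sum fun i _ =>
          mul_le_mul ((le_abs_self _).trans (hC i x)) (hle i) (hnn i)
            ((abs_nonneg _).trans (hC i x))
      _ = (∑ i, C i * (2 * ε n)) * ‖x‖ := by
          rw [Finset.sum_mul]
          exact Finset.sum_congr rfl fun i _ => by ring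

theorem exists_inner_simple_eq (Δ : Module.Basis (Fin n) ℝ V) (y : Fin n → ℝ) :
    ∃ x : V, ∀ i, ⟪x, Δ i⟫_ℝ = y i := by
  have : CompleteSpace V := FiniteDimensional.complete ℝ V
  refine ⟨(InnerProductSpace.toDual ℝ V).symm
    (LinearMap.toContinuousLinearMap (Δ.constr ℝ y)), fun i => ?_⟩
  rw [InnerProductSpace.toDual_symm_apply]
  simp

/-- The nestohedron has nonempty interior relative to its hyperplane. -/
theorem exists_relint_nestohedron (hΦ : IsRootSystem Φ) (hΔ : IsSimpleBasis Φ Δ)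
    (hG : IsBuildingSet Φ G) (hn : 0 < n) (hε : IsSuitable Φ Δ G ε) :
    ∃ x ∈ nestohedron Φ Δ G ε, ∀ v, ⟪v, delta Φ Δ⟫_ℝ = 0 →
      ∃ t : ℝ, 0 < t ∧ x + t • v ∈ nestohedron Φ Δ G ε := by
  have hεn := hε.pos n hn le_rfl
  have hn' : (0 : ℝ) < n := Nat.cast_pos.mpr hn
  have hc := coeff_delta_pos hΦ hΔ
  -- Chosen so that every simple root contributes the same amount ε n / n to ⟪x, δ⟫.
  obtain ⟨x, hx⟩ := exists_inner_simple_eq Δ fun i => ε n / (n * Δ.repr (delta Φ Δ) i)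
  have hxδ : ⟪x, delta Φ Δ⟫_ℝ = ε n := by
    rw [inner_delta, Finset.sum_congr rfl (g := fun _ => ε n / n)]
    · rw [Finset.sum_const, Finset.card_univ, Fintype.card_fin, nsmul_eq_mul]
      field_simp
    · intro i _
      have := hc i
      rw [hx]
      field_simp
  have hstrict : ∀ I : Finset (Fin n), I.Nonempty → fundSpan Δ I ∈ G → I ≠ Finset.univ →
      ε I.card < ⟪x, piVec Φ Δ (fundSpan Δ I)⟫_ℝ := by
    intro I hne hI hI'
    have hcard : I.card < n := by
      simpa using Finset.card_lt_card (Finset.ssubset_univ_iff.mpr hI')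
    have hcard' : 1 ≤ I.card := Finset.card_pos.mpr hne
    obtain ⟨k, hk⟩ := Nat.exists_eq_add_of_le hcard.le
    have hεI := hε.pos _ hcard' hcard.le
    -- Each of the I.card terms of ⟪x, π_I⟫ exceeds 2^k ε_{|I|} / n, so this count gives the strict
    -- bound.
    have hcnt : (n : ℝ) ≤ I.card * 2 ^ k := by
      have h1 : k < 2 ^ k := Nat.lt_two_pow_self
      have : n ≤ I.card * 2 ^ k := by nlinarith
      exact_mod_cast this
    have hterm : ∀ i ∈ I, 2 ^ k / n * ε I.card <
        Δ.repr (piVec Φ Δ (fundSpan Δ I)) i * ⟪x, Δ i⟫_ℝ := fun i hi => by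
      have h1 := (pow_mul_coeff_le hΦ hΔ hG hε k hI hk.symm hi).2 (by omega)
      have h2 : 0 < Δ.repr (delta Φ Δ) i := by linarith [hc i]
      rw [hx, mul_div_assoc', div_mul_eq_mul_div, div_lt_div_iff₀ hn' (by positivity)]
      calc 2 ^ k * ε I.card * (n * Δ.repr (delta Φ Δ) i)
          = 2 ^ k * Δ.repr (delta Φ Δ) i * ε I.card * n := by ring
        _ < _ := by gcongr
    rw [inner_piVec]
    refine lt_of_le_of_lt ?_ (Finset.sum_lt_sum_of_nonempty hne hterm)
    rw [Finset.sum_const, nsmul_eq_mul, ← mul_assoc, mul_div_assoc', le_mul_iff_one_le_left hεI,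
      one_le_div hn']
    exact hcnt
  refine ⟨x, mem_nestohedron.mpr ⟨hxδ, fun I h1 h2 h3 => (hstrict I h1 h2 h3).le⟩, fun v hv => ?_⟩
  have hev : ∀ᶠ t : ℝ in nhdsWithin 0 (Set.Ioi 0), ∀ I : Finset (Fin n), I.Nonempty →
      fundSpan Δ I ∈ G → I ≠ Finset.univ →
      ε I.card < ⟪x + t • v, piVec Φ Δ (fundSpan Δ I)⟫_ℝ := by
    refine Filter.eventually_all.mpr fun I => ?_
    by_cases h : I.Nonempty ∧ fundSpan Δ I ∈ G ∧ I ≠ Finset.univ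
    · have hcont : Continuous fun t : ℝ => ⟪x + t • v, piVec Φ Δ (fundSpan Δ I)⟫_ℝ := by fun_prop
      have h0 : ε I.card < ⟪x + (0 : ℝ) • v, piVec Φ Δ (fundSpan Δ I)⟫_ℝ := by
        rw [zero_smul, add_zero]
        exact hstrict I h.1 h.2.1 h.2.2
      filter_upwards [nhdsWithin_le_nhds
        (hcont.continuousAt.eventually (lt_mem_nhds h0))] with t ht _ _ _
      exact ht
    · exact Filter.Eventually.of_forall fun t h1 h2 h3 => absurd ⟨h1, h2, h3⟩ h
  obtain ⟨t, ht, ht0⟩ := (hev.and self_mem_nhdsWithin).exists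
  refine ⟨t, ht0, mem_nestohedron.mpr ⟨?_, fun I h1 h2 h3 => (ht I h1 h2 h3).le⟩⟩
  rw [inner_add_left, real_inner_smul_left, hv, hxδ, mul_zero, add_zero]

/-- A linear isometry sending the nestohedron into itself fixes `δ`. -/
theorem map_delta_of_mapsTo_nestohedron (hΦ : IsRootSystem Φ) (hΔ : IsSimpleBasis Φ Δ)
    (hG : IsBuildingSet Φ G) (hn : 0 < n) (hε : IsSuitable Φ Δ G ε) {g : V ≃ₗᵢ[ℝ] V}
    (hg : ∀ x ∈ nestohedron Φ Δ G ε, g x ∈ nestohedron Φ Δ G ε) :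
    g (delta Φ Δ) = delta Φ Δ := by
  obtain ⟨x, hx, hint⟩ := exists_relint_nestohedron hΦ hΔ hG hn hε
  have hεn := hε.pos n hn le_rfl
  have hxδ := (mem_nestohedron.mp hx).1
  have hgx := (mem_nestohedron.mp (hg x hx)).1
  set δ := delta Φ Δ
  have hδ0 : ‖δ‖ ^ 2 ≠ 0 := by
    intro h
    have : δ = 0 := by simpa using h
    rw [this, inner_zero_right] at hxδ
    exact hεn.ne hxδ
  have hadj : ∀ v, ⟪g v, δ⟫_ℝ = ⟪v, g.symm δ⟫_ℝ := fun v => by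
    rw [← g.symm.inner_map_map, LinearIsometryEquiv.symm_apply_apply]
  -- A small move along v stays in the nestohedron, so its image stays in H_V. Hence g⁻¹ δ is
  -- orthogonal to δ^⊥, that is, a multiple of δ.
  have hperp : ∀ v, ⟪v, δ⟫_ℝ = 0 → ⟪v, g.symm δ⟫_ℝ = 0 := fun v hv => by
    obtain ⟨t, ht, hmem⟩ := hint v hv
    have h := (mem_nestohedron.mp (hg _ hmem)).1
    rw [map_add, map_smul, inner_add_left, real_inner_smul_left, hgx, add_eq_left] at h
    rw [← hadj]
    exact (mul_eq_zero.mp h).resolve_left ht.ne'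
  set c := ⟪g.symm δ, δ⟫_ℝ / ‖δ‖ ^ 2
  have h1 : ⟪g.symm δ - c • δ, δ⟫_ℝ = 0 := by
    rw [inner_sub_left, real_inner_smul_left, real_inner_self_eq_norm_sq, div_mul_cancel₀ _ hδ0,
      sub_self]
  have h2 := hperp _ h1
  have h3 : g.symm δ = c • δ := by
    rw [← sub_eq_zero, ← inner_self_eq_zero (𝕜 := ℝ)]
    conv_lhs => rw [inner_sub_right, real_inner_smul_right, h1, h2, mul_zero, sub_zero]
  have hc : c = 1 := by
    have h4 := hadj x
    rw [hgx, h3, real_inner_smul_right, hxδ] at h4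
    exact (mul_right_cancel₀ hεn.ne' (h4.symm.trans (one_mul _).symm))
  rw [hc, one_smul] at h3
  rw [← LinearIsometryEquiv.eq_symm_apply, h3]

/-! ### Isometries permuting the nestohedra of the chambers -/

theorem eq_zero_of_weyl_invariant (hΦ : IsRootSystem Φ) {v : V}
    (hv : ∀ w ∈ weylGroup Φ, w v = v) : v = 0 := by
  have h : ∀ α ∈ Φ, ⟪α, v⟫_ℝ = 0 := fun α hα => by
    have h1 := hv _ (rootReflection_mem_weylGroup hα)
    rw [rootReflection_apply, sub_eq_self, smul_eq_zero, or_iff_left (hΦ.ne_zero hα)] at h1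
    simpa using (div_eq_zero_iff.mp h1).resolve_right (hΦ.norm_sq_pos hα).ne'
  have hmem : v ∈ Submodule.span ℝ (Φ : Set V) := hΦ.span_eq_top ▸ Submodule.mem_top
  rw [← inner_self_eq_zero (𝕜 := ℝ)]
  refine Submodule.span_induction (p := fun u _ => ⟪u, v⟫_ℝ = 0) (fun u hu => h u hu) (by simp)
    (fun x y _ _ hx hy => by rw [inner_add_left, hx, hy, add_zero])
    (fun c x _ hx => by rw [real_inner_smul_left, hx, mul_zero]) hmem

/-- The orbit sum of y is W-invariant, hence 0, so the pairings with c cannot all be positive. -/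
theorem exists_weyl_inner_nonpos (hΦ : IsRootSystem Φ) (y c : V) :
    ∃ w ∈ weylGroup Φ, ⟪w y, c⟫_ℝ ≤ 0 := by
  by_contra! h
  have := hΦ.finite_weylGroup
  have := Fintype.ofFinite (weylGroup Φ)
  have h0 : ∑ w : weylGroup Φ, w.1 y = 0 := by
    refine eq_zero_of_weyl_invariant hΦ fun u hu => ?_
    rw [map_sum]
    exact Fintype.sum_equiv (Equiv.mulLeft (⟨u, hu⟩ : weylGroup Φ)) _ _ fun w => rfl
  have h1 : 0 < ∑ w : weylGroup Φ, ⟪w.1 y, c⟫_ℝ :=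
    Finset.sum_pos (fun w _ => h w.1 w.2) Finset.univ_nonempty
  rw [← sum_inner, h0, inner_zero_left] at h1
  exact lt_irrefl _ h1

variable {θ : V ≃ᵢ V} (hθ : (fun N : Set V => θ '' N) '' chamberNestohedra Φ Δ G ε =
  chamberNestohedra Φ Δ G ε)
include hθ

theorem exists_image_eq {w : V ≃ₗᵢ[ℝ] V} (hw : w ∈ weylGroup Φ) : ∃ w' ∈ weylGroup Φ,
    θ '' (w '' nestohedron Φ Δ G ε) = w' '' nestohedron Φ Δ G ε := by
  have h : θ '' (w '' nestohedron Φ Δ G ε) ∈ chamberNestohedra Φ Δ G ε := by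
    rw [← hθ]; exact ⟨_, ⟨w, hw, rfl⟩, rfl⟩
  exact h

theorem exists_eq_image {w : V ≃ₗᵢ[ℝ] V} (hw : w ∈ weylGroup Φ) : ∃ w' ∈ weylGroup Φ,
    θ '' (w' '' nestohedron Φ Δ G ε) = w '' nestohedron Φ Δ G ε := by
  have h : w '' nestohedron Φ Δ G ε ∈ chamberNestohedra Φ Δ G ε := ⟨w, hw, rfl⟩
  rw [← hθ] at h
  obtain ⟨_, ⟨w', hw', rfl⟩, h⟩ := h
  exact ⟨w', hw', h⟩

/-- If c = θ 0 ≠ 0, rotate a point y of the nestohedron so that ⟪w y, c⟫ ≤ 0. Its θ-preimage has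
squared norm at least ‖y‖² + ‖c‖² and lies in some nestohedron; iterating contradicts boundedness.
-/
theorem map_zero_of_permutes (hΦ : IsRootSystem Φ) (hΔ : IsSimpleBasis Φ Δ)
    (hG : IsBuildingSet Φ G) (hn : 0 < n) (hε : IsSuitable Φ Δ G ε) : θ 0 = 0 := by
  by_contra hc
  have hc' : 0 < ‖θ 0‖ ^ 2 := by
    have := norm_pos_iff.mpr hc
    positivity
  obtain ⟨K, hK⟩ := exists_norm_le_of_mem_nestohedron hΦ hΔ hG hε
  obtain ⟨x₀, hx₀, -⟩ := exists_relint_nestohedron hΦ hΔ hG hn hε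
  have key : ∀ k : ℕ, ∃ y ∈ nestohedron Φ Δ G ε, k * ‖θ 0‖ ^ 2 ≤ ‖y‖ ^ 2 := fun k => by
    induction k with
    | zero => exact ⟨x₀, hx₀, by simp⟩
    | succ k ih =>
      obtain ⟨y, hy, hky⟩ := ih
      obtain ⟨w, hw, hwy⟩ := exists_weyl_inner_nonpos hΦ y (θ 0)
      obtain ⟨w', -, h⟩ := exists_eq_image hθ hw
      have hmem : w y ∈ θ '' (w' '' nestohedron Φ Δ G ε) := h ▸ ⟨y, hy, rfl⟩
      obtain ⟨_, ⟨z, hz, rfl⟩, hzw⟩ := hmem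
      refine ⟨z, hz, ?_⟩
      have h1 : ‖z‖ = ‖w y - θ 0‖ := by
        rw [← hzw, ← dist_eq_norm, θ.isometry.dist_eq, dist_zero_right, w'.norm_map]
      rw [h1, norm_sub_sq_real, w.norm_map]
      push_cast
      linarith
  obtain ⟨k, hk⟩ := exists_nat_gt (K ^ 2 / ‖θ 0‖ ^ 2)
  obtain ⟨y, hy, hky⟩ := key k
  rw [div_lt_iff₀ hc'] at hk
  have := pow_le_pow_left₀ (norm_nonneg y) (hK y hy) 2
  linarith

/-- An isometry permuting the nestohedra of the chambers is a linear automorphism of `Φ`. -/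
theorem exists_rootAut_of_permutes (hΦ : IsRootSystem Φ) (hΔ : IsSimpleBasis Φ Δ)
    (hG : IsBuildingSet Φ G) (hn : 0 < n) (hε : IsSuitable Φ Δ G ε) :
    ∃ f ∈ rootAut Φ, ∀ x, f x = θ x := by
  set L : V ≃ₗᵢ[ℝ] V :=
    θ.toRealLinearIsometryEquivOfMapZero (map_zero_of_permutes hθ hΦ hΔ hG hn hε) with hLdef
  have hL : ∀ x, L x = θ x := fun x => rfl
  -- The map w'⁻¹ L w sends the fundamental nestohedron into itself, so it fixes δ.
  have hδ : ∀ {w w' : V ≃ₗᵢ[ℝ] V},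
      θ '' (w '' nestohedron Φ Δ G ε) = w' '' nestohedron Φ Δ G ε →
      L (w (delta Φ Δ)) = w' (delta Φ Δ) := fun {w w'} h => by
    have := map_delta_of_mapsTo_nestohedron hΦ hΔ hG hn hε (g := w'.symm * (L * w)) fun x hx => by
      have hm : θ (w x) ∈ w' '' nestohedron Φ Δ G ε := h ▸ ⟨_, ⟨x, hx, rfl⟩, rfl⟩
      obtain ⟨y, hy, hyx⟩ := hm
      change w'.symm (L (w x)) ∈ _
      rwa [hL, ← hyx, LinearIsometryEquiv.symm_apply_apply]
    change w'.symm (L (w (delta Φ Δ))) = _ at this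
    rwa [LinearIsometryEquiv.symm_apply_eq] at this
  obtain ⟨u, hu, h1⟩ := exists_image_eq hθ (one_mem (weylGroup Φ))
  have hu1 : L (delta Φ Δ) = u (delta Φ Δ) := hδ h1
  set g : V ≃ₗᵢ[ℝ] V := u⁻¹ * L with hg
  have hgx : ∀ x, g x = u.symm (L x) := fun x => rfl
  have hgsx : ∀ x, g.symm x = L.symm (u x) := fun x => rfl
  have hgδ : g (delta Φ Δ) = delta Φ Δ := by rw [hgx, hu1, LinearIsometryEquiv.symm_apply_apply]
  have hgδ' : g.symm (delta Φ Δ) = delta Φ Δ := by rw [LinearIsometryEquiv.symm_apply_eq, hgδ]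
  have hsub : ∀ i, Δ i = delta Φ Δ - rootReflection (Δ i) (delta Φ Δ) := fun i => by
    rw [IsSimpleBasis.rootReflection_delta hΦ hΔ, sub_sub_cancel]
  have hcone : ∀ i j, 0 ≤ Δ.repr (g (Δ i)) j := fun i j => by
    obtain ⟨w', hw', h⟩ := exists_image_eq hθ (rootReflection_mem_weylGroup (hΔ.mem i))
    have hm : u⁻¹ * w' ∈ weylGroup Φ := mul_mem (inv_mem hu) hw'
    have e : g (Δ i) = delta Φ Δ - (u⁻¹ * w') (delta Φ Δ) := by
      conv_lhs => rw [hsub i, map_sub, hgδ, hgx, hδ h]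
      rfl
    rw [e]
    exact IsSimpleBasis.repr_delta_sub_nonneg hΔ (fun α hα => hΦ.weyl_apply_mem hm hα) j
  -- Here g⁻¹ s_i δ = L⁻¹ (u s_i δ), so the nestohedron to pull back is the one indexed by u s_i.
  have hcone' : ∀ i j, 0 ≤ Δ.repr (g.symm (Δ i)) j := fun i j => by
    obtain ⟨w', hw', h⟩ := exists_eq_image hθ
      (mul_mem hu (rootReflection_mem_weylGroup (hΔ.mem i)))
    have e : g.symm (Δ i) = delta Φ Δ - w' (delta Φ Δ) := by
      conv_lhs => rw [hsub i, map_sub, hgδ', hgsx]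
      congr 1
      rw [LinearIsometryEquiv.symm_apply_eq, hδ h]
      rfl
    rw [e]
    exact IsSimpleBasis.repr_delta_sub_nonneg hΔ (fun α hα => hΦ.weyl_apply_mem hw' hα) j
  have hgΦ := IsSimpleBasis.map_mem_of_simple hΦ hΔ
    (IsSimpleBasis.exists_simple_of_cone hΦ hΔ hgδ hcone hcone')
  have hLΦ : ∀ α ∈ Φ, L α ∈ Φ := fun α hα => by
    have := hΦ.weyl_apply_mem hu (hgΦ α hα)
    rwa [hgx, LinearIsometryEquiv.apply_symm_apply] at this
  refine ⟨L.toLinearEquiv, ?_, hL⟩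
  change L '' (Φ : Set V) = Φ
  classical
  rw [← Finset.coe_image, Finset.coe_inj]
  refine Finset.eq_of_subset_of_card_le (fun β hβ => ?_)
    (by rw [Finset.card_image_of_injective _ L.injective])
  obtain ⟨α, hα, rfl⟩ := Finset.mem_image.mp hβ
  exact hLΦ α hα

end Nestohedra

end Permutonestohedra

end

/-! ### The two inclusions between the automorphism groups -/

open Permutonestohedra in
theorem mainTheorem6 {V : Type*} [NormedAddCommGroup V] [InnerProductSpace ℝ V]
    [FiniteDimensional ℝ V] {n : ℕ}
    (Φ : Finset V) (hΦ : IsRootSystem Φ) (hnorm : IsNormalized Φ)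
    (Δ : Module.Basis (Fin n) ℝ V) (hΔ : IsSimpleBasis Φ Δ)
    (G : Set (Submodule ℝ V)) (hG : IsBuildingSet Φ G) (hV : ⊤ ∈ G)
    (ε : ℕ → ℝ) (hε : IsSuitable Φ Δ G ε)
    (hGinv : ∀ f ∈ rootAut Φ, ∀ A ∈ G, A.map (f : V →ₗ[ℝ] V) ∈ G) :
    (rootAut Φ).map linearToPerm ≤
        (isometryAut (permutonestohedron Φ Δ G ε)).map isometryToPerm ∧
      ((∀ θ ∈ isometryAut (permutonestohedron Φ Δ G ε),
          (fun N : Set V => θ '' N) '' chamberNestohedra Φ Δ G ε = chamberNestohedra Φ Δ G ε) →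
        (rootAut Φ).map linearToPerm =
          (isometryAut (permutonestohedron Φ Δ G ε)).map isometryToPerm) := by
  have h1 : (rootAut Φ).map linearToPerm ≤
      (isometryAut (permutonestohedron Φ Δ G ε)).map isometryToPerm := by
    rintro _ ⟨f, hf, rfl⟩
    refine ⟨(f.isometryOfInner (hΦ.inner_map_map hnorm hf)).toIsometryEquiv, ?_, rfl⟩
    change f '' permutonestohedron Φ Δ G ε = permutonestohedron Φ Δ G ε
    refine Set.Subset.antisymm ?_ fun x hx => ?_
    · rintro _ ⟨x, hx, rfl⟩
      exact rootAut_mem_permutonestohedron hΦ hnorm hΔ hGinv hf hx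
    · exact ⟨_, rootAut_mem_permutonestohedron hΦ hnorm hΔ hGinv
        (IsRootSystem.symm_mem_rootAut hf) hx, f.apply_symm_apply x⟩
  refine ⟨h1, fun hperm => le_antisymm h1 ?_⟩
  rintro _ ⟨θ, hθ, rfl⟩
  obtain ⟨f, hf, hfθ⟩ := exists_rootAut_of_permutes (hperm θ hθ) hΦ hΔ hG
    (pos_rank hΦ Δ hG hV) hε
  exact ⟨f, hf, Equiv.ext hfθ⟩
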